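/- **Setting.** Let $B,B^Y,B^Z$ be mutually independent standard $d$-dimensional Brownian motions on a probability space $(\Omega,\mathcal F,\mathbb P)$. Let $\kappa,\sigma\in\mathbb R^{d\times d}$ with $\Sigma=\sigma\sigma'$ invertible, $\bar\theta,x_0\in\mathbb R^d$, and let $X$ be the Ornstein–Uhlenbeck process $$dX_t=\kappa(\bar\theta-X_t)\,dt+\sigma\,dB_t,\qquad X_0=x_0,\quad 0\le t\le 1 .$$ Put $\mu(x,s)=\bar\theta+e^{-s\kappa}(x-\bar\theta)$, $\Sigma(s)=\int_0^s e^{-(s-u)\kappa}\Sigma e^{-(s-u)\kappa'}du$ and $P(s)=\Sigma(s)^{-1}$ for $s>0$. **Assumptions.** $\tau\in C[0,1]\cap C^1[0,1)$ is strictly increasing with $\tau(0)=0$, $\tau(1)=1$; $\gamma,p,\omega\in C[0,1)$ are strictly positive; $C_I,D_Z$ are symmetric positive definite $d\times d$ matrices; $\omega_0\in\mathbb R$ satisfies $\int_0^1\omega(\tau(u))\,du<1-\omega_0$ (in particular the integral is finite). **The $N$-th market** ($N\ge 1$). For $n=1,\dots,2^N+1$ let $r^N_n=(n-1)2^{-N}$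 and $t^N_n=\tau(r^N_n)$. For $n=1,\dots,2^N$ define $$\omega^N_n=2^{-N}\omega(t^N_n)\ (n\ge 2),\qquad \omega^N_1=1-\omega_0-2^{-N}\sum_{n=2}^{2^N}\omega(t^N_n),\qquad \alpha^N_n=\frac{\omega^N_n}{\gamma(t^N_n)},$$ $$C^N_n=p(t^N_n)C_I,\qquad D^N_n=\frac{1}{t^N_{n+1}-t^N_n}D_Z,$$ $$Y^N_n=p(t^N_n)^{-1/2}C_I^{-1/2}(B^Y_n-B^Y_{n-1}),\qquad Z^N_n=D_Z^{-1/2}\int_{r^N_n}^{r^N_{n+1}}\sqrt{\dot\tau(u)}\,dB^Z_u .$$ Consider those $N$ with $\omega^N_1\ne 0$ (in particular all $N$ for which the weights are positive); for them define $$E^N_n=\Big((C^N_n)^{-1}+(\alpha^N_n)^{-2}(C^N_n)^{-1}(D^N_n)^{-1}(C^N_n)^{-1}\Big)^{-1},\qquad H^N_n=X_1+Y^N_n+\frac1{\alpha^N_n}(C^N_n)^{-1}Z^N_n,$$ $$F^N_n=\sum_{m=1}^nE^N_m,\qquad J^N_n=(F^N_n)^{-1}\sum_{m=1}^nE^N_mH^N_m,$$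 $$\theta^{N,n}_t(j)=\sigma'e^{-(1-t)\kappa'}P(1-t)\big(P(1-t)+F^N_n\big)^{-1}F^N_n\big(j-\mu(X_t,1-t)\big),\qquad j\in\mathbb R^d,\ 0\le t<1,$$ and the information drift $$\theta^N_t=\sum_{n=1}^{2^N}\theta^{N,n}_t(J^N_n)\,1_{\{t^N_n<t\le t^N_{n+1}\}}\quad(0<t<1),\qquad \theta^N_0=\theta^{N,1}_0(J^N_1).$$ **Proposition.** For every fixed $t\in[0,1)$ the processes $\theta^N$ are ($\mathbb P\times\mathrm{Leb}_{[0,t]}$-a.e. equal to) jointly measurable functions on $\Omega\times[0,t]$ and are uniformly bounded in $L^2(\mathbb P\times\mathrm{Leb}_{[0,t]})$: $$\sup_N\ \mathbb E\Big[\int_0^t|\theta^N_u|^2\,du\Big]<\infty,$$ where the supremum is over all $N\ge1$ with $\omega^N_1\neq0$. -/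

import Mathlib

open MeasureTheory ProbabilityTheory
open scoped NNReal ENNReal Matrix

/-- State space `ℝ^d` with the Euclidean norm. -/
abbrev Vec (d : ℕ) : Type := EuclideanSpace ℝ (Fin d)

/-- Real `d × d` matrices. -/
abbrev Mat (d : ℕ) : Type := Matrix (Fin d) (Fin d) ℝ

/-- The matrix `M` acting on the vector `v`. -/
noncomputable def act {d : ℕ} (M : Mat d) (v : Vec d) : Vec d :=
  Matrix.toEuclideanCLM (𝕜 := ℝ) M v

open scoped MatrixOrder in
/-- `M^{-1/2}` for a positive definite matrix `M`: the positive square root of the inverse. -/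
noncomputable def invSqrt {d : ℕ} (M : Mat d) : Mat d := CFC.sqrt M⁻¹

/-- Standard `d`-dimensional Brownian motion: the coordinates are independent real Brownian
motions. -/
structure IsBrownianVec {Ω : Type*} [MeasurableSpace Ω] {d : ℕ}
    (W : ℝ≥0 → Ω → Vec d) (P : Measure Ω) : Prop where
  measurable : ∀ t, Measurable (W t)
  coord : ∀ i, IsBrownianReal (fun t w => W t w i) P
  indep : iIndepFun (fun (i : Fin d) (w : Ω) (t : ℝ≥0) => W t w i) P

/-- `I` is (a version of) the Wiener integral `∫_a^b f(u) dW_u` of the deterministic scalar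
function `f ∈ L²(a,b)`: the pair `(f, I)` is an `L²`-limit of pairs formed by a step function on
`(a,b]` and its elementary integral. -/
def IsWienerIntegral {Ω : Type*} [MeasurableSpace Ω] {d : ℕ} (P : Measure Ω)
    (W : ℝ≥0 → Ω → Vec d) (f : ℝ → ℝ) (a b : ℝ) (I : Ω → Vec d) : Prop :=
  MemLp f 2 (volume.restrict (Set.Ioc a b)) ∧ MemLp I 2 P ∧
    ∀ ε : ℝ≥0∞, 0 < ε → ∃ (m : ℕ) (s : ℕ → ℝ≥0) (c : ℕ → ℝ),
      Monotone s ∧ (∀ i, (s i : ℝ) ∈ Set.Icc a b) ∧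
      eLpNorm (fun u => f u - ∑ i ∈ Finset.range m,
          Set.indicator (Set.Ioc (s i : ℝ) (s (i + 1) : ℝ)) (fun _ => c i) u) 2
        (volume.restrict (Set.Ioc a b)) ≤ ε ∧
      eLpNorm (fun w => I w - ∑ i ∈ Finset.range m, c i • (W (s (i + 1)) w - W (s i) w)) 2 P ≤ ε

/-- The deterministic data of the sequence of markets. -/
structure MarketData (d : ℕ) where
  /-- mean reversion matrix of the fundamental process -/
  kappa : Mat d
  /-- mean reversion level of the fundamental process -/
  level : Vec d
  /-- volatility matrix of the fundamental process -/
  sigma : Mat d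
  /-- initial value of the fundamental process -/
  x₀ : Vec d
  /-- time change generating the signal times -/
  tau : ℝ → ℝ
  /-- risk aversion of an insider, as a function of her signal time -/
  gamma : ℝ → ℝ
  /-- scalar signal precision, as a function of the signal time -/
  prec : ℝ → ℝ
  /-- base matrix of the insider signal precisions -/
  CI : Mat d
  /-- base matrix of the noise trader demand precisions -/
  DZ : Mat d
  /-- weight of the uninformed agent -/
  omega₀ : ℝ
  /-- weight density of the insiders, as a function of the signal time -/
  omega : ℝ → ℝ

namespace MarketData

variable {d : ℕ} (M : MarketData d)

/-- The standing assumptions on the deterministic data. -/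
structure Admissible : Prop where
  invertible : IsUnit (M.sigma * M.sigmaᵀ)
  tau_cont : ContinuousOn M.tau (Set.Icc 0 1)
  tau_C1 : ContDiffOn ℝ 1 M.tau (Set.Ico 0 1)
  tau_strictMono : StrictMonoOn M.tau (Set.Icc 0 1)
  tau_zero : M.tau 0 = 0
  tau_one : M.tau 1 = 1
  gamma_cont : ContinuousOn M.gamma (Set.Ico 0 1)
  gamma_pos : ∀ t ∈ Set.Ico (0 : ℝ) 1, 0 < M.gamma t
  prec_cont : ContinuousOn M.prec (Set.Ico 0 1)
  prec_pos : ∀ t ∈ Set.Ico (0 : ℝ) 1, 0 < M.prec t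
  CI_posDef : M.CI.PosDef
  DZ_posDef : M.DZ.PosDef
  omega_cont : ContinuousOn M.omega (Set.Ico 0 1)
  omega_pos : ∀ t ∈ Set.Ico (0 : ℝ) 1, 0 < M.omega t
  omega_integrable : IntegrableOn (fun u => M.omega (M.tau u)) (Set.Ioo 0 1)
  omega_integral_lt : ∫ u in Set.Ioo (0 : ℝ) 1, M.omega (M.tau u) < 1 - M.omega₀

/-! ### The fundamental process -/

/-- `X` is, on `[0,1]`, the Ornstein-Uhlenbeck process
`dX = κ(θ - X) dt + σ dB`, `X_0 = x₀`, with continuous paths. -/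
structure IsOU {Ω : Type*} [MeasurableSpace Ω] (P : Measure Ω) (B : ℝ≥0 → Ω → Vec d)
    (X : ℝ → Ω → Vec d) : Prop where
  measurable : ∀ t, Measurable (X t)
  cont : ∀ᵐ w ∂P, ContinuousOn (fun t => X t w) (Set.Icc 0 1)
  sde : ∀ᵐ w ∂P, ∀ t ∈ Set.Icc (0 : ℝ) 1,
    X t w = M.x₀ + (∫ s in (0 : ℝ)..t, act M.kappa (M.level - X s w))
      + act M.sigma (B t.toNNReal w)

/-- Conditional mean `μ(x,s) = θ + e^{-sκ}(x - θ)`. -/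
noncomputable def condMean (x : Vec d) (s : ℝ) : Vec d :=
  M.level + act (NormedSpace.exp (-(s • M.kappa))) (x - M.level)

/-- Conditional covariance `Σ(s) = ∫_0^s e^{-(s-u)κ} σσ' e^{-(s-u)κ'} du` (entrywise integral). -/
noncomputable def condCov (s : ℝ) : Mat d :=
  Matrix.of fun i j => ∫ u in (0 : ℝ)..s,
    (NormedSpace.exp (-((s - u) • M.kappa)) * (M.sigma * M.sigmaᵀ) *
      NormedSpace.exp (-((s - u) • M.kappaᵀ))) i j

/-- Conditional precision `P(s) = Σ(s)^{-1}`. -/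
noncomputable def condPrec (s : ℝ) : Mat d := (M.condCov s)⁻¹

/-! ### The `N`-th market: insiders `n = 1, …, 2^N` -/

/-- The dyadic rational `r^N_n = (n - 1) / 2^N`. -/
noncomputable def dyadic (N n : ℕ) : ℝ := ((n : ℝ) - 1) / 2 ^ N

/-- Signal time `t^N_n = τ(r^N_n)`; in particular `t^N_{2^N+1} = τ(1) = 1`. -/
noncomputable def time (N n : ℕ) : ℝ := M.tau (dyadic N n)

/-- Weight `ω^N_n` of the `n`-th insider. -/
noncomputable def weight (N n : ℕ) : ℝ :=
  if n = 1 then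
    1 - M.omega₀ - 1 / 2 ^ N * ∑ m ∈ Finset.Icc 2 (2 ^ N), M.omega (M.time N m)
  else 1 / 2 ^ N * M.omega (M.time N n)

/-- Weighted risk tolerance `α^N_n = ω^N_n / γ^N_n`. -/
noncomputable def alpha (N n : ℕ) : ℝ := M.weight N n / M.gamma (M.time N n)

/-- Precision `C^N_n` of the private signal of the `n`-th insider. -/
noncomputable def C (N n : ℕ) : Mat d := M.prec (M.time N n) • M.CI

/-- Precision `D^N_n` of the `n`-th incremental noise trader demand. -/
noncomputable def D (N n : ℕ) : Mat d := (1 / (M.time N (n + 1) - M.time N n)) • M.DZ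

/-- Precision `E^N_n` of the `n`-th market signal. -/
noncomputable def E (N n : ℕ) : Mat d :=
  ((M.C N n)⁻¹ + (1 / M.alpha N n ^ 2) • ((M.C N n)⁻¹ * (M.D N n)⁻¹ * (M.C N n)⁻¹))⁻¹

/-- Effective market precision `F^N_n = ∑_{m ≤ n} E^N_m`. -/
noncomputable def F (N n : ℕ) : Mat d := ∑ m ∈ Finset.Icc 1 n, M.E N m

section Random

variable {Ω : Type*} (BY : ℝ≥0 → Ω → Vec d) (X : ℝ → Ω → Vec d) (Z : ℕ → ℕ → Ω → Vec d)

/-- Noise of the private signal: `Y^N_n = p(t^N_n)^{-1/2} C_I^{-1/2} (B^Y_n - B^Y_{n-1})`. -/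
noncomputable def Y (N n : ℕ) (w : Ω) : Vec d :=
  (Real.sqrt (M.prec (M.time N n)))⁻¹ •
    act (invSqrt M.CI) (BY (n : ℝ≥0) w - BY ((n - 1 : ℕ) : ℝ≥0) w)

/-- `Z^N_n` is the `n`-th incremental noise trader demand
`D_Z^{-1/2} ∫_{r^N_n}^{r^N_{n+1}} √(τ'(u)) dB^Z_u`. -/
def IsNoiseDemand [MeasurableSpace Ω] (P : Measure Ω) (BZ : ℝ≥0 → Ω → Vec d)
    (N n : ℕ) (z : Ω → Vec d) : Prop :=
  ∃ I : Ω → Vec d,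
    IsWienerIntegral P BZ (fun u => Real.sqrt (derivWithin M.tau (Set.Ico 0 1) u))
      (dyadic N n) (dyadic N (n + 1)) I ∧
    z =ᵐ[P] fun w => act (invSqrt M.DZ) (I w)

/-- Private signal `G^N_n = X_1 + Y^N_n`. -/
noncomputable def G (N n : ℕ) (w : Ω) : Vec d := X 1 w + M.Y BY N n w

/-- Market signal `H^N_n = G^N_n + (1/α^N_n) (C^N_n)^{-1} Z^N_n`. -/
noncomputable def H (N n : ℕ) (w : Ω) : Vec d :=
  M.G BY X N n w + (1 / M.alpha N n) • act (M.C N n)⁻¹ (Z N n w)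

/-- Effective market signal `J^N_n = (F^N_n)^{-1} ∑_{m ≤ n} E^N_m H^N_m`. -/
noncomputable def J (N n : ℕ) (w : Ω) : Vec d :=
  act (M.F N n)⁻¹ (∑ m ∈ Finset.Icc 1 n, act (M.E N m) (M.H BY X Z N m w))

/-- `θ^{N,n}_t(j) = σ' e^{-(1-t)κ'} P(1-t) (P(1-t) + F^N_n)^{-1} F^N_n (j - μ(X_t, 1-t))`. -/
noncomputable def driftAt (N n : ℕ) (t : ℝ) (w : Ω) (j : Vec d) : Vec d :=
  act (M.sigmaᵀ * NormedSpace.exp (-((1 - t) • M.kappaᵀ)) * M.condPrec (1 - t) *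
      (M.condPrec (1 - t) + M.F N n)⁻¹ * M.F N n)
    (j - M.condMean (X t w) (1 - t))

open Classical in
/-- Information drift `θ^N_t = ∑_n θ^{N,n}_t(J^N_n) 1_{t^N_n < t ≤ t^N_{n+1}}` of the `N`-th
market, with `θ^N_0 = θ^{N,1}_0(J^N_1)`. -/
noncomputable def infoDrift (N : ℕ) (t : ℝ) (w : Ω) : Vec d :=
  if t = 0 then M.driftAt X N 1 0 w (M.J BY X Z N 1 w)
  else ∑ n ∈ Finset.Icc 1 (2 ^ N),
    if M.time N n < t ∧ t ≤ M.time N (n + 1) then M.driftAt X N n t w (M.J BY X Z N n w) else 0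

end Random

end MarketData

/-! Put `Q = (P(1-u) + F)⁻¹`, where `F` is the market precision of the active insider. Inserting the
definition of the effective signal gives (`driftAt_J_eq`) drift = `σ' e^{-(1-u)κ'} P(1-u)` applied
to `Q F (X_1 - μ(X_u, 1-u)) + Q ∑ E_m Y_m + Q ∑ E_m α_m⁻¹ C_m⁻¹ Z_m`. No bound on `F` is used as the
market grows, so each term is estimated uniformly over all positive semidefinite `F`.

For the first term, `Q F = 1 - Q P` and `tr Q ≤ tr P⁻¹ = tr Σ(1-u)`, so `Q F` is bounded without
reference to `F` (`inv_add_mul`, `trace_inv_add_le`); the process `X` is bounded in `L²` by a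
pathwise Grönwall argument.

For the noise, `E_m⁻¹` is by definition the sum of the covariances of `Y_m` and of `α_m⁻¹ C_m⁻¹
Z_m`. Within each sum the summands are orthogonal, so the covariance of either sum is dominated by
`∑ E_m E_m⁻¹ E_m = F`. After applying `Q`, the second moment is at most `tr(Q F Q) ≤ tr Q ≤ tr
Σ(1-u)` (`lintegral_sum_Y_le`, `lintegral_sum_Z_le`, `trace_conj_inv_add_le`). For `Z` this needs
the Itô isometry, obtained by passing to the limit from step functions.

All remaining coefficients are continuous on `[0,t]`, because `Σ(1-u)` stays invertible for `u ≤ t <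
1`. At each `u ≠ 0` at most one insider is active, so Tonelli yields a bound `K t` with `K`
independent of `N`. -/

/-! ### Second moments of orthogonal families -/

section SecondMoments

variable {Ω : Type*} [MeasurableSpace Ω] {P : Measure Ω}

/-- Second moment of a linear combination of pairwise orthogonal square integrable variables. -/
lemma integral_sq_sum_of_orthogonal {ι : Type*} [DecidableEq ι] (T : Finset ι) (η : ι → Ω → ℝ)
    (a v : ι → ℝ) (hη : ∀ p ∈ T, MemLp (η p) 2 P)
    (h : ∀ p ∈ T, ∀ q ∈ T, ∫ w, η p w * η q w ∂P = if p = q then v p else 0) :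
    ∫ w, (∑ p ∈ T, a p * η p w) ^ 2 ∂P = ∑ p ∈ T, a p ^ 2 * v p := by
  have hexp : ∀ w, (∑ p ∈ T, a p * η p w) ^ 2
      = ∑ p ∈ T, ∑ q ∈ T, (a p * a q) * (η p w * η q w) := by
    intro w
    rw [sq, Finset.sum_mul_sum]
    exact Finset.sum_congr rfl fun p _ => Finset.sum_congr rfl fun q _ => by ring
  have hint : ∀ p ∈ T, ∀ q ∈ T, Integrable (fun w => (a p * a q) * (η p w * η q w)) P :=
    fun p hp q hq => ((hη p hp).integrable_mul (hη q hq)).const_mul _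
  simp_rw [hexp]
  rw [integral_finsetSum _ fun p hp => integrable_finsetSum _ fun q hq => hint p hp q hq]
  refine Finset.sum_congr rfl fun p hp => ?_
  rw [integral_finsetSum _ fun q hq => hint p hp q hq]
  simp_rw [integral_const_mul]
  rw [Finset.sum_congr rfl fun q hq => by rw [h p hp q hq]]
  simp [hp, sq]

/-- `Vec`-valued version: second moment of `∑ A_m ζ_m` for orthogonal isotropic vectors `ζ_m`. -/
lemma lintegral_sum_act_of_orthogonal {d : ℕ} {ι : Type*} [DecidableEq ι] (T : Finset ι)
    (ζ : ι → Ω → Vec d) (A : ι → Mat d) (v : ι → ℝ) (hζ : ∀ m ∈ T, MemLp (ζ m) 2 P)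
    (h : ∀ m ∈ T, ∀ n ∈ T, ∀ i j,
      ∫ w, ζ m w i * ζ n w j ∂P = if m = n ∧ i = j then v m else 0) :
    ∫⁻ w, ‖∑ m ∈ T, act (A m) (ζ m w)‖ₑ ^ 2 ∂P
      = ENNReal.ofReal (∑ m ∈ T, v m * (A m * (A m)ᵀ).trace) := by
  have hc : ∀ m ∈ T, ∀ i, MemLp (fun w => ζ m w i) 2 P := fun m hm i =>
    (hζ m hm).continuousLinearMap_comp (EuclideanSpace.proj (𝕜 := ℝ) i)
  have hV : MemLp (fun w => ∑ m ∈ T, act (A m) (ζ m w)) 2 P :=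
    memLp_finsetSum _ fun m hm =>
      (hζ m hm).continuousLinearMap_comp (Matrix.toEuclideanCLM (𝕜 := ℝ) (A m))
  -- Each coordinate is a scalar combination indexed by the pairs `(m, i)`, and the variables `ζ m
  -- i` form an orthogonal family over these pairs.
  have hco : ∀ w k, (∑ m ∈ T, act (A m) (ζ m w)) k
      = ∑ p ∈ T ×ˢ (Finset.univ : Finset (Fin d)), A p.1 k p.2 * ζ p.1 w p.2 := by
    intro w k
    rw [Finset.sum_product]
    simp [act, Matrix.mulVec, dotProduct]
  have hco2 : ∀ k, MemLp (fun w => ∑ p ∈ T ×ˢ (Finset.univ : Finset (Fin d)),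
      A p.1 k p.2 * ζ p.1 w p.2) 2 P := fun k =>
    memLp_finsetSum _ fun (p : ι × Fin d) hp =>
      (hc p.1 (Finset.mem_product.1 hp).1 p.2).const_mul (A p.1 k p.2)
  have hsq : ∀ w, ‖∑ m ∈ T, act (A m) (ζ m w)‖ₑ ^ 2
      = ENNReal.ofReal (‖∑ m ∈ T, act (A m) (ζ m w)‖ ^ 2) := by
    intro w
    rw [← ofReal_norm, ENNReal.ofReal_pow (norm_nonneg _)]
  simp_rw [hsq]
  rw [← ofReal_integral_eq_lintegral_ofReal]
  · congr 1
    simp_rw [EuclideanSpace.norm_sq_eq, hco, Real.norm_eq_abs, sq_abs]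
    rw [integral_finsetSum _ fun k _ => (hco2 k).integrable_sq]
    have : ∀ k, ∫ w, (∑ p ∈ T ×ˢ (Finset.univ : Finset (Fin d)), A p.1 k p.2 * ζ p.1 w p.2) ^ 2 ∂P
        = ∑ p ∈ T ×ˢ (Finset.univ : Finset (Fin d)), A p.1 k p.2 ^ 2 * v p.1 := by
      intro k
      refine integral_sq_sum_of_orthogonal _ (fun (p : ι × Fin d) w => ζ p.1 w p.2) _
        (fun p => v p.1) ?_ ?_
      · exact fun p hp => hc p.1 (Finset.mem_product.1 hp).1 p.2
      · intro p hp q hq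
        rw [h p.1 (Finset.mem_product.1 hp).1 q.1 (Finset.mem_product.1 hq).1]
        simp only [Prod.ext_iff]
    simp_rw [this, Finset.sum_product]
    rw [Finset.sum_comm]
    refine Finset.sum_congr rfl fun m _ => ?_
    simp only [Matrix.trace, Matrix.diag, Matrix.mul_apply, Matrix.transpose_apply, Finset.mul_sum]
    exact Finset.sum_congr rfl fun k _ => Finset.sum_congr rfl fun i _ => by ring
  · exact (hV.integrable_norm_pow (by norm_num))
  · exact Filter.Eventually.of_forall fun w => by positivity

/-- Continuity of `(F, G) ↦ ∫ F G` along sequences converging in `L²`. -/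
lemma tendsto_integral_mul_of_tendsto_eLpNorm {F G : ℕ → Ω → ℝ} {f g : Ω → ℝ}
    (hF : ∀ n, MemLp (F n) 2 P) (hG : ∀ n, MemLp (G n) 2 P) (hf : MemLp f 2 P) (hg : MemLp g 2 P)
    (h1 : Filter.Tendsto (fun n => eLpNorm (F n - f) 2 P) Filter.atTop (nhds 0))
    (h2 : Filter.Tendsto (fun n => eLpNorm (G n - g) 2 P) Filter.atTop (nhds 0)) :
    Filter.Tendsto (fun n => ∫ w, F n w * G n w ∂P) Filter.atTop (nhds (∫ w, f w * g w ∂P)) := by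
  -- The integral of a product is the `L²` inner product, whose joint continuity gives the claim.
  have key : ∀ {u v : Ω → ℝ} (hu : MemLp u 2 P) (hv : MemLp v 2 P),
      inner ℝ (hu.toLp u) (hv.toLp v) = ∫ w, u w * v w ∂P := by
    intro u v hu hv
    rw [L2.inner_def]
    refine integral_congr_ae ?_
    filter_upwards [hu.coeFn_toLp, hv.coeFn_toLp] with w h h'
    rw [h, h']
    simp [mul_comm]
  have t1 : Filter.Tendsto (fun n => (hF n).toLp (F n)) Filter.atTop (nhds (hf.toLp f)) :=
    (Lp.tendsto_Lp_iff_tendsto_eLpNorm'' F hF f hf).2 h1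
  have t2 : Filter.Tendsto (fun n => (hG n).toLp (G n)) Filter.atTop (nhds (hg.toLp g)) :=
    (Lp.tendsto_Lp_iff_tendsto_eLpNorm'' G hG g hg).2 h2
  have := t1.inner t2 (𝕜 := ℝ)
  simpa only [key] using this

end SecondMoments

/-! ### Itô isometry for Wiener integrals -/

section Brownian

variable {Ω : Type*} [MeasurableSpace Ω] {P : Measure Ω} {d : ℕ} {W : ℝ≥0 → Ω → Vec d}

lemma IsBrownianVec.memLp_coord (hW : IsBrownianVec W P) (t : ℝ≥0) (i : Fin d) :
    MemLp (fun w => W t w i) 2 P :=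
  ((hW.coord i).hasLaw_eval t).hasGaussianLaw.memLp_two

lemma IsBrownianVec.memLp (hW : IsBrownianVec W P) (t : ℝ≥0) : MemLp (W t) 2 P :=
  MemLp.of_eval_piLp fun i => hW.memLp_coord t i

lemma IsBrownianVec.integral_mul [IsProbabilityMeasure P] (hW : IsBrownianVec W P) (s t : ℝ≥0)
    (i j : Fin d) :
    ∫ w, W s w i * W t w j ∂P = if i = j then (min s t : ℝ) else 0 := by
  have hz : ∀ t i, ∫ w, W t w i ∂P = 0 := fun t i => (hW.coord i).integral_eval t
  have hcov : cov[fun w => W s w i, fun w => W t w j; P] = ∫ w, W s w i * W t w j ∂P := by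
    rw [covariance_eq_sub (hW.memLp_coord s i) (hW.memLp_coord t j), hz, zero_mul, sub_zero]
    rfl
  rw [← hcov]
  split_ifs with hij
  · subst hij
    simpa using (hW.coord i).covariance_fun_eval s t
  · have := (hW.indep.indepFun hij).comp (φ := fun x : ℝ≥0 → ℝ => x s)
      (ψ := fun x : ℝ≥0 → ℝ => x t) (measurable_pi_apply (X := fun _ : ℝ≥0 => ℝ) s)
      (measurable_pi_apply (X := fun _ : ℝ≥0 => ℝ) t)
    exact this.covariance_eq_zero (hW.memLp_coord s i) (hW.memLp_coord t j)

/-- Covariance of increments as the integral of a product of indicators. -/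
lemma IsBrownianVec.integral_sub_mul_sub [IsProbabilityMeasure P] (hW : IsBrownianVec W P)
    {a b c e : ℝ≥0} (hab : a ≤ b) (hce : c ≤ e) (i j : Fin d) :
    ∫ w, (W b w i - W a w i) * (W e w j - W c w j) ∂P
      = if i = j then ∫ u : ℝ, (Set.Ioc (a : ℝ) b).indicator (fun _ => (1 : ℝ)) u *
          (Set.Ioc (c : ℝ) e).indicator (fun _ => (1 : ℝ)) u else 0 := by
  have hI : ∀ s t, Integrable (fun w => W s w i * W t w j) P := fun s t =>
    (hW.memLp_coord s i).integrable_mul (hW.memLp_coord t j)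
  have h1 : ∀ w, (W b w i - W a w i) * (W e w j - W c w j)
      = W b w i * W e w j - W b w i * W c w j - (W a w i * W e w j - W a w i * W c w j) :=
    fun w => by ring
  simp_rw [h1]
  rw [integral_sub (by exact (hI _ _).sub (hI _ _)) (by exact (hI _ _).sub (hI _ _)),
    integral_sub (hI _ _) (hI _ _), integral_sub (hI _ _) (hI _ _)]
  simp_rw [hW.integral_mul]
  split_ifs with hij
  · have h2 : ∀ u : ℝ, (Set.Ioc (a : ℝ) b).indicator (fun _ => (1 : ℝ)) u *
          (Set.Ioc (c : ℝ) e).indicator (fun _ => (1 : ℝ)) u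
        = (Set.Ioc (max (a : ℝ) c) (min (b : ℝ) e)).indicator (fun _ => (1 : ℝ)) u := by
      intro u
      rw [← Set.Ioc_inter_Ioc]
      simp only [Set.indicator_apply, Set.mem_inter_iff]
      split_ifs <;> simp_all
    simp_rw [h2]
    rw [integral_indicator measurableSet_Ioc]
    simp only [integral_const, MeasurableSet.univ, measureReal_restrict_apply, Set.univ_inter,
      smul_eq_mul, mul_one, Real.volume_real_Ioc]
    -- The signed sum of the four minima is the length of the overlap of `(a,b]` and `(c,e]`; this
    -- needs both intervals to be correctly oriented.
    have h3 : (a : ℝ) ≤ b := hab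
    have h4 : (c : ℝ) ≤ e := hce
    grind
  · simp

/-- The step function with values `c i` on `(s i, s (i + 1)]`, `i < m`. -/
noncomputable def stepFun (m : ℕ) (s : ℕ → ℝ≥0) (c : ℕ → ℝ) (u : ℝ) : ℝ :=
  ∑ i ∈ Finset.range m, Set.indicator (Set.Ioc (s i : ℝ) (s (i + 1) : ℝ)) (fun _ => c i) u

/-- The elementary integral of `stepFun m s c` against `W`. -/
noncomputable def stepIntegral (W : ℝ≥0 → Ω → Vec d) (m : ℕ) (s : ℕ → ℝ≥0) (c : ℕ → ℝ) (w : Ω) :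
    Vec d :=
  ∑ i ∈ Finset.range m, c i • (W (s (i + 1)) w - W (s i) w)

lemma memLp_indicator_Ioc (a b c : ℝ) :
    MemLp (Set.indicator (Set.Ioc a b) (fun _ => c)) 2 volume :=
  memLp_indicator_const 2 measurableSet_Ioc c (Or.inr measure_Ioc_lt_top.ne)

lemma memLp_stepFun (m : ℕ) (s : ℕ → ℝ≥0) (c : ℕ → ℝ) : MemLp (stepFun m s c) 2 volume :=
  memLp_finsetSum _ fun _ _ => memLp_indicator_Ioc _ _ _

lemma IsBrownianVec.memLp_stepIntegral (hW : IsBrownianVec W P) (m : ℕ) (s : ℕ → ℝ≥0)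
    (c : ℕ → ℝ) : MemLp (stepIntegral W m s c) 2 P :=
  memLp_finsetSum _ fun i _ =>
    ((hW.memLp (s (i + 1))).sub (hW.memLp (s i))).const_smul (c i)

/-- Turns approximation in `L²(a,b)` into approximation in `L²(ℝ)`, so that Wiener integrals over
different intervals can be compared in one space. -/
lemma indicator_Ioc_stepFun {a b : ℝ} {m : ℕ} {s : ℕ → ℝ≥0} (c : ℕ → ℝ)
    (hs : ∀ i, (s i : ℝ) ∈ Set.Icc a b) :
    Set.indicator (Set.Ioc a b) (stepFun m s c) = stepFun m s c := by
  rw [Set.indicator_eq_self]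
  intro u hu
  obtain ⟨i, -, hi⟩ := Finset.exists_ne_zero_of_sum_ne_zero (Function.mem_support.1 hu)
  have := Set.mem_of_indicator_ne_zero hi
  exact ⟨(hs i).1.trans_lt this.1, this.2.trans (hs (i + 1)).2⟩

/-- The Itô isometry for elementary integrals. -/
lemma IsBrownianVec.integral_stepIntegral_mul [IsProbabilityMeasure P] (hW : IsBrownianVec W P)
    {m m' : ℕ} {s s' : ℕ → ℝ≥0} (c c' : ℕ → ℝ) (hs : Monotone s) (hs' : Monotone s')
    (i j : Fin d) :
    ∫ w, stepIntegral W m s c w i * stepIntegral W m' s' c' w j ∂P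
      = if i = j then ∫ u, stepFun m s c u * stepFun m' s' c' u else 0 := by
  have h1 : ∀ w, stepIntegral W m s c w i * stepIntegral W m' s' c' w j
      = ∑ k ∈ Finset.range m, ∑ l ∈ Finset.range m', c k * c' l *
        ((W (s (k + 1)) w i - W (s k) w i) * (W (s' (l + 1)) w j - W (s' l) w j)) := by
    intro w
    simp only [stepIntegral, WithLp.ofLp_sum, WithLp.ofLp_smul, WithLp.ofLp_sub, Finset.sum_apply,
      Pi.smul_apply, Pi.sub_apply, smul_eq_mul]
    rw [Finset.sum_mul_sum]
    exact Finset.sum_congr rfl fun p _ => Finset.sum_congr rfl fun q _ => by ring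
  have h2 : ∀ u, stepFun m s c u * stepFun m' s' c' u
      = ∑ k ∈ Finset.range m, ∑ l ∈ Finset.range m', c k * c' l *
        ((Set.Ioc (s k : ℝ) (s (k + 1))).indicator (fun _ => (1 : ℝ)) u *
          (Set.Ioc (s' l : ℝ) (s' (l + 1))).indicator (fun _ => (1 : ℝ)) u) := by
    intro u
    simp only [stepFun]
    rw [Finset.sum_mul_sum]
    refine Finset.sum_congr rfl fun p _ => Finset.sum_congr rfl fun q _ => ?_
    simp only [Set.indicator_apply]
    split_ifs <;> simp
  have hI1 : ∀ k l, Integrable (fun w => c k * c' l *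
      ((W (s (k + 1)) w i - W (s k) w i) * (W (s' (l + 1)) w j - W (s' l) w j))) P := fun k l =>
    (((hW.memLp_coord _ i).sub (hW.memLp_coord _ i)).integrable_mul
      ((hW.memLp_coord _ j).sub (hW.memLp_coord _ j))).const_mul _
  have hI2 : ∀ k l, Integrable (fun u => c k * c' l *
        ((Set.Ioc (s k : ℝ) (s (k + 1))).indicator (fun _ => (1 : ℝ)) u *
          (Set.Ioc (s' l : ℝ) (s' (l + 1))).indicator (fun _ => (1 : ℝ)) u)) := fun k l =>
    ((memLp_indicator_Ioc _ _ _).integrable_mul (memLp_indicator_Ioc _ _ _)).const_mul _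
  simp_rw [h1, h2]
  rw [integral_finsetSum _ fun k _ => integrable_finsetSum _ fun l _ => hI1 k l,
    integral_finsetSum _ fun k _ => integrable_finsetSum _ fun l _ => hI2 k l]
  simp_rw [integral_finsetSum _ fun l _ => hI1 _ l, integral_finsetSum _ fun l _ => hI2 _ l,
    integral_const_mul,
    hW.integral_sub_mul_sub (hs (Nat.le_succ _)) (hs' (Nat.le_succ _))]
  split_ifs <;> simp

/-- Approximation of a Wiener integral by elementary integrals. -/
lemma IsWienerIntegral.exists_seq {f : ℝ → ℝ} {a b : ℝ} {I : Ω → Vec d}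
    (h : IsWienerIntegral P W f a b I) :
    ∃ (m : ℕ → ℕ) (s : ℕ → ℕ → ℝ≥0) (c : ℕ → ℕ → ℝ), (∀ n, Monotone (s n)) ∧
      Filter.Tendsto (fun n => eLpNorm (stepFun (m n) (s n) (c n) - (Set.Ioc a b).indicator f) 2
        volume) Filter.atTop (nhds 0) ∧
      ∀ i, Filter.Tendsto (fun n => eLpNorm ((fun w => stepIntegral W (m n) (s n) (c n) w i)
        - fun w => I w i) 2 P) Filter.atTop (nhds 0) := by
  have hpos : ∀ n : ℕ, (0 : ℝ≥0∞) < ((n : ℝ≥0∞) + 1)⁻¹ := fun n => by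
    rw [ENNReal.inv_pos]; exact ENNReal.add_ne_top.2 ⟨ENNReal.natCast_ne_top n, ENNReal.one_ne_top⟩
  choose m s c hs hab h1 h2 using fun n : ℕ => h.2.2 _ (hpos n)
  have hlim : Filter.Tendsto (fun n : ℕ => ((n : ℝ≥0∞) + 1)⁻¹) Filter.atTop (nhds 0) := by
    have := (Filter.tendsto_add_atTop_iff_nat 1).2 ENNReal.tendsto_inv_nat_nhds_zero
    simpa using this
  refine ⟨m, s, c, hs, ?_, fun i => ?_⟩
  · refine tendsto_of_tendsto_of_tendsto_of_le_of_le tendsto_const_nhds hlim (fun _ => zero_le)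
      fun n => ?_
    refine le_trans (le_of_eq ?_) (h1 n)
    rw [eLpNorm_sub_comm, ← indicator_Ioc_stepFun (c n) (hab n), ← Set.indicator_sub',
      eLpNorm_indicator_eq_eLpNorm_restrict measurableSet_Ioc]
    rfl
  · refine tendsto_of_tendsto_of_tendsto_of_le_of_le tendsto_const_nhds hlim (fun _ => zero_le)
      fun n => ?_
    refine le_trans ?_ (h2 n)
    rw [eLpNorm_sub_comm]
    exact eLpNorm_mono fun w => PiLp.norm_apply_le (I w - stepIntegral W (m n) (s n) (c n) w) i

/-- The Itô isometry. -/
lemma IsWienerIntegral.integral_mul [IsProbabilityMeasure P] {f f' : ℝ → ℝ} {a b a' b' : ℝ}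
    {I I' : Ω → Vec d} (hW : IsBrownianVec W P) (h : IsWienerIntegral P W f a b I)
    (h' : IsWienerIntegral P W f' a' b' I') (i j : Fin d) :
    ∫ w, I w i * I' w j ∂P
      = if i = j then ∫ u, (Set.Ioc a b).indicator f u * (Set.Ioc a' b').indicator f' u else 0 := by
  obtain ⟨m, s, c, hs, h1, h2⟩ := h.exists_seq
  obtain ⟨m', s', c', hs', h1', h2'⟩ := h'.exists_seq
  have hco : ∀ (V : Ω → Vec d) (_ : MemLp V 2 P) i, MemLp (fun w => V w i) 2 P := fun V hV i =>
    hV.continuousLinearMap_comp (EuclideanSpace.proj (𝕜 := ℝ) i)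
  have t1 := tendsto_integral_mul_of_tendsto_eLpNorm
    (fun n => hco _ (hW.memLp_stepIntegral (m n) (s n) (c n)) i)
    (fun n => hco _ (hW.memLp_stepIntegral (m' n) (s' n) (c' n)) j)
    (hco _ h.2.1 i) (hco _ h'.2.1 j) (h2 i) (h2' j)
  have t2 := tendsto_integral_mul_of_tendsto_eLpNorm
    (fun n => memLp_stepFun (m n) (s n) (c n)) (fun n => memLp_stepFun (m' n) (s' n) (c' n))
    ((memLp_indicator_iff_restrict measurableSet_Ioc).2 h.1)
    ((memLp_indicator_iff_restrict measurableSet_Ioc).2 h'.1) h1 h1'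
  simp_rw [hW.integral_stepIntegral_mul _ _ (hs _) (hs' _)] at t1
  refine tendsto_nhds_unique t1 ?_
  split_ifs
  · exact t2
  · exact tendsto_const_nhds

end Brownian

/-! ### Trace inequalities for positive semidefinite matrices -/

section MatrixBounds

variable {d : ℕ}

lemma act_add (A : Mat d) (v w : Vec d) : act A (v + w) = act A v + act A w := map_add _ _ _

lemma act_sub (A : Mat d) (v w : Vec d) : act A (v - w) = act A v - act A w := map_sub _ _ _

lemma act_sum {ι : Type*} (A : Mat d) (T : Finset ι) (v : ι → Vec d) :
    act A (∑ m ∈ T, v m) = ∑ m ∈ T, act A (v m) := map_sum _ _ _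

lemma act_mul (A B : Mat d) (v : Vec d) : act (A * B) v = act A (act B v) := by
  simp [act, map_mul]

lemma act_one (v : Vec d) : act (1 : Mat d) v = v := by simp [act]

lemma act_sub_left (A B : Mat d) (v : Vec d) : act (A - B) v = act A v - act B v := by
  simp [act, map_sub]

lemma act_smul_left (A : Mat d) (c : ℝ) (v : Vec d) : act (c • A) v = c • act A v := by
  simp [act, map_smul]

lemma act_sum_left {ι : Type*} (T : Finset ι) (A : ι → Mat d) (v : Vec d) :
    act (∑ m ∈ T, A m) v = ∑ m ∈ T, act (A m) v := by
  simp only [act, map_sum, sum_apply]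

lemma norm_act_le (A : Mat d) (v : Vec d) :
    ‖act A v‖ ≤ ‖Matrix.toEuclideanCLM (𝕜 := ℝ) A‖ * ‖v‖ :=
  (Matrix.toEuclideanCLM (𝕜 := ℝ) A).le_opNorm v

lemma trace_mul_transpose_eq (A : Mat d) : (A * Aᵀ).trace = ∑ i, ∑ j, A i j ^ 2 := by
  simp [Matrix.trace, Matrix.mul_apply, sq]

/-- Cauchy–Schwarz in each row: the Frobenius norm dominates the operator norm. -/
lemma norm_act_sq_le_trace (A : Mat d) (v : Vec d) :
    ‖act A v‖ ^ 2 ≤ (A * Aᵀ).trace * ‖v‖ ^ 2 := by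
  rw [trace_mul_transpose_eq, EuclideanSpace.norm_sq_eq, EuclideanSpace.norm_sq_eq, Finset.sum_mul]
  refine Finset.sum_le_sum fun i _ => ?_
  simp only [Real.norm_eq_abs, sq_abs]
  exact Finset.sum_mul_sq_le_sq_mul_sq Finset.univ (A i) v

open scoped MatrixOrder in
lemma invSqrt_posSemidef (A : Mat d) : (invSqrt A).PosSemidef :=
  Matrix.nonneg_iff_posSemidef.1 (CFC.sqrt_nonneg _)

open scoped MatrixOrder in
lemma Matrix.PosDef.invSqrt_mul_self {A : Mat d} (hA : A.PosDef) :
    invSqrt A * invSqrt A = A⁻¹ :=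
  CFC.sqrt_mul_sqrt_self _ (Matrix.nonneg_iff_posSemidef.2 hA.inv.posSemidef)

lemma Matrix.PosSemidef.transpose_eq {A : Mat d} (hA : A.PosSemidef) : Aᵀ = A := by
  simpa [Matrix.IsHermitian] using hA.isHermitian

lemma Matrix.PosDef.isUnit_det {A : Mat d} (hA : A.PosDef) : IsUnit A.det :=
  (Matrix.isUnit_iff_isUnit_det A).1 hA.isUnit

lemma Matrix.PosSemidef.conj {A : Mat d} (hA : A.PosSemidef) {B : Mat d} (hB : B.PosSemidef) :
    (B * A * B).PosSemidef := by
  have := hA.mul_mul_conjTranspose_same B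
  rwa [hB.isHermitian.eq] at this

/-- The Frobenius norm of a positive semidefinite matrix is at most its trace. -/
lemma Matrix.PosSemidef.trace_mul_transpose_le {Q : Mat d} (hQ : Q.PosSemidef) :
    (Q * Qᵀ).trace ≤ Q.trace ^ 2 := by
  obtain ⟨B, rfl⟩ : ∃ B : Mat d, Q = Bᴴ * B := by
    open scoped MatrixOrder in
    refine ⟨CFC.sqrt Q, ?_⟩
    rw [(Matrix.nonneg_iff_posSemidef.1 (CFC.sqrt_nonneg Q)).isHermitian.eq]
    exact (CFC.sqrt_mul_sqrt_self Q (Matrix.nonneg_iff_posSemidef.2 hQ)).symm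
  rw [trace_mul_transpose_eq]
  have h : ∀ i j, (Bᴴ * B) i j = ∑ k, B k i * B k j := fun i j => by simp [Matrix.mul_apply]
  simp only [Matrix.trace, Matrix.diag, h]
  rw [sq, Finset.sum_mul_sum]
  refine Finset.sum_le_sum fun i _ => Finset.sum_le_sum fun j _ => ?_
  simpa [sq] using Finset.sum_mul_sq_le_sq_mul_sq Finset.univ (fun k => B k i) (fun k => B k j)

/-- Removes the uncontrolled factor `F`: the right side is bounded as soon as `A` and `(A + F)⁻¹`
are. -/
lemma Matrix.PosDef.inv_add_mul {A F : Mat d} (hA : A.PosDef) (hF : F.PosSemidef) :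
    (A + F)⁻¹ * F = 1 - (A + F)⁻¹ * A := by
  have h := Matrix.nonsing_inv_mul _ (hA.add_posSemidef hF).isUnit_det
  rw [mul_add] at h
  rw [← h]; abel

/-- With `Q = (A + F)⁻¹`, the identity `A⁻¹ = Q + Q (F + F A⁻¹ F) Q` exhibits the difference `A⁻¹ -
Q` as positive semidefinite. -/
lemma Matrix.PosDef.trace_inv_add_le {A F : Mat d} (hA : A.PosDef) (hF : F.PosSemidef) :
    (A + F)⁻¹.trace ≤ A⁻¹.trace := by
  have hAF := hA.add_posSemidef hF
  have h1 := Matrix.nonsing_inv_mul _ hAF.isUnit_det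
  have h2 := Matrix.mul_nonsing_inv _ hAF.isUnit_det
  have h3 := Matrix.mul_nonsing_inv _ hA.isUnit_det
  have h4 := Matrix.nonsing_inv_mul _ hA.isUnit_det
  have hQ : ((A + F)⁻¹).PosSemidef := hAF.inv.posSemidef
  set Q := (A + F)⁻¹
  have key : A⁻¹ = Q + Q * (F + F * A⁻¹ * F) * Q := by
    have e : F + F * A⁻¹ * F = (A + F) * A⁻¹ * (A + F) - (A + F) := by
      have : (A + F) * A⁻¹ * (A + F)
          = (A * A⁻¹) * A + (A * A⁻¹) * F + F * (A⁻¹ * A) + F * A⁻¹ * F := by noncomm_ring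
      rw [this, h3, h4]; noncomm_ring
    rw [e]
    have : Q * ((A + F) * A⁻¹ * (A + F) - (A + F)) * Q
        = (Q * (A + F)) * A⁻¹ * ((A + F) * Q) - (Q * (A + F)) * Q := by noncomm_ring
    rw [this, h1, h2]; simp
  have hpsd : (F + F * A⁻¹ * F).PosSemidef := hF.add (hA.inv.posSemidef.conj hF)
  have := (hpsd.conj hQ).trace_nonneg
  rw [key, Matrix.trace_add]
  linarith

/-- With `Q = (A + F)⁻¹`, one has `Q F Q = Q - Q A Q`, and the subtracted term has nonnegative
trace. -/
lemma Matrix.PosDef.trace_conj_inv_add_le {A F : Mat d} (hA : A.PosDef) (hF : F.PosSemidef) :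
    ((A + F)⁻¹ * F * (A + F)⁻¹).trace ≤ A⁻¹.trace := by
  refine le_trans ?_ (hA.trace_inv_add_le hF)
  have hQ : ((A + F)⁻¹).PosSemidef := (hA.add_posSemidef hF).inv.posSemidef
  have := (hA.posSemidef.conj hQ).trace_nonneg
  rw [hA.inv_add_mul hF, sub_mul, one_mul, Matrix.trace_sub]
  linarith

/-- `E = E S E` split along `S = E⁻¹ = A + R` and conjugated by `Q`. -/
lemma trace_conj_inv_add_split {A R : Mat d} (hA : A.PosDef) (hR : R.PosSemidef) (Q : Mat d) :
    (Q * (A + R)⁻¹ * A * (A + R)⁻¹ * Q).trace + (Q * (A + R)⁻¹ * R * (A + R)⁻¹ * Q).trace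
      = (Q * (A + R)⁻¹ * Q).trace := by
  have h1 := Matrix.nonsing_inv_mul _ (hA.add_posSemidef hR).isUnit_det
  rw [← Matrix.trace_add]
  congr 1
  have : Q * (A + R)⁻¹ * A * (A + R)⁻¹ * Q + Q * (A + R)⁻¹ * R * (A + R)⁻¹ * Q
      = Q * ((A + R)⁻¹ * (A + R)) * (A + R)⁻¹ * Q := by noncomm_ring
  rw [this, h1, mul_one]

end MatrixBounds

/-! ### Continuity and positivity of the conditional covariance -/

namespace MarketData

variable {d : ℕ} (M : MarketData d)

section CondCov

attribute [local instance] Matrix.linftyOpNormedRing Matrix.linftyOpNormedAlgebra in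
lemma continuous_exp_neg_smul (A : Mat d) :
    Continuous fun s : ℝ => NormedSpace.exp (-(s • A)) := by
  exact NormedSpace.exp_continuous.comp (by fun_prop)

/-- The integrand of the conditional covariance, after reversing time. -/
noncomputable def covDensity (v : ℝ) : Mat d :=
  NormedSpace.exp (-(v • M.kappa)) * (M.sigma * M.sigmaᵀ) * NormedSpace.exp (-(v • M.kappaᵀ))

lemma continuous_covDensity : Continuous M.covDensity :=
  ((continuous_exp_neg_smul _).matrix_mul continuous_const).matrix_mul (continuous_exp_neg_smul _)

/-- The substitution `v = s - u` frees the integrand of `s`; continuity in `s` is then that of a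
primitive. -/
lemma condCov_apply (s : ℝ) (i j : Fin d) :
    M.condCov s i j = ∫ v in (0 : ℝ)..s, M.covDensity v i j := by
  have := intervalIntegral.integral_comp_sub_left (a := 0) (b := s)
    (fun v => M.covDensity v i j) s
  simpa [condCov, covDensity] using this

lemma continuous_condCov : Continuous M.condCov := by
  refine continuous_matrix fun i j => ?_
  simp_rw [condCov_apply]
  exact intervalIntegral.continuous_primitive
    (fun a b => (M.continuous_covDensity.matrix_elem i j).intervalIntegrable a b) 0

/-- A congruence of the invertible, hence definite, matrix `σσ'` by an invertible exponential. -/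
lemma covDensity_posDef (h : IsUnit (M.sigma * M.sigmaᵀ)) (v : ℝ) : (M.covDensity v).PosDef := by
  have hS : (M.sigma * M.sigmaᵀ).PosDef := by
    have := Matrix.posSemidef_self_mul_conjTranspose M.sigma
    rw [Matrix.conjTranspose_eq_transpose_of_trivial] at this
    exact this.posDef_iff_isUnit.2 h
  have h1 : NormedSpace.exp (-(v • M.kappaᵀ)) = (NormedSpace.exp (-(v • M.kappa)))ᴴ := by
    rw [Matrix.conjTranspose_eq_transpose_of_trivial, ← Matrix.exp_transpose]
    simp
  rw [covDensity, h1]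
  exact (Matrix.IsUnit.posDef_star_right_conjugate_iff (Matrix.isUnit_exp _)).2 hS

lemma condCov_posDef (h : IsUnit (M.sigma * M.sigmaᵀ)) {s : ℝ} (hs : 0 < s) :
    (M.condCov s).PosDef := by
  have hsymm : ∀ v i j, M.covDensity v i j = M.covDensity v j i := fun v i j => by
    simpa using (M.covDensity_posDef h v).isHermitian.apply j i
  have hint : ∀ i j, IntervalIntegrable (fun v => M.covDensity v i j) volume 0 s := fun i j =>
    (M.continuous_covDensity.matrix_elem i j).intervalIntegrable _ _
  refine Matrix.PosDef.of_dotProduct_mulVec_pos ?_ fun x hx => ?_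
  · ext i j
    simp only [Matrix.conjTranspose_apply, condCov_apply, star_trivial]
    simp_rw [hsymm _ j i]
  · have e : star x ⬝ᵥ (M.condCov s *ᵥ x)
        = ∫ v in (0 : ℝ)..s, star x ⬝ᵥ (M.covDensity v *ᵥ x) := by
      simp only [dotProduct, Matrix.mulVec, condCov_apply, Finset.mul_sum]
      rw [intervalIntegral.integral_finsetSum fun i _ => ?_]
      · refine Finset.sum_congr rfl fun i _ => ?_
        rw [intervalIntegral.integral_finsetSum fun j _ => ?_]
        · simp [intervalIntegral.integral_const_mul, intervalIntegral.integral_mul_const]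
        · exact ((hint i j).mul_const _).const_mul _
      · refine Continuous.intervalIntegrable ?_ _ _
        have := M.continuous_covDensity
        fun_prop
    rw [e]
    refine intervalIntegral.intervalIntegral_pos_of_pos ?_
      (fun v => (M.covDensity_posDef h v).dotProduct_mulVec_pos hx) hs
    refine Continuous.intervalIntegrable ?_ _ _
    have := M.continuous_covDensity
    fun_prop

end CondCov

end MarketData

/-! ### Signal times and positivity of the precisions -/

namespace MarketData

variable {d : ℕ} {M : MarketData d}

section Deterministic

lemma dyadic_nonneg {N n : ℕ} (h1 : 1 ≤ n) : 0 ≤ dyadic N n := by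
  have : (1 : ℝ) ≤ n := by exact_mod_cast h1
  exact div_nonneg (by linarith) (by positivity)

lemma dyadic_lt_one {N n : ℕ} (h2 : n ≤ 2 ^ N) : dyadic N n < 1 := by
  have : (n : ℝ) ≤ 2 ^ N := by exact_mod_cast h2
  rw [dyadic, div_lt_one (by positivity)]
  linarith

lemma dyadic_succ_le_one {N n : ℕ} (h2 : n ≤ 2 ^ N) : dyadic N (n + 1) ≤ 1 := by
  have : (n : ℝ) ≤ 2 ^ N := by exact_mod_cast h2
  rw [dyadic, div_le_one (by positivity)]
  push_cast
  linarith

lemma dyadic_mono (N : ℕ) : Monotone (dyadic N) := fun a b hab => by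
  have : (a : ℝ) ≤ b := by exact_mod_cast hab
  rw [dyadic, dyadic]
  gcongr

lemma dyadic_lt_succ (N n : ℕ) : dyadic N n < dyadic N (n + 1) := by
  rw [dyadic, dyadic]
  push_cast
  gcongr
  linarith

lemma Admissible.time_mem (hM : M.Admissible) {N n : ℕ} (h1 : 1 ≤ n) (h2 : n ≤ 2 ^ N) :
    M.time N n ∈ Set.Ico (0 : ℝ) 1 := by
  have h0 := dyadic_nonneg (N := N) h1
  have h3 := dyadic_lt_one h2
  constructor
  · rw [← hM.tau_zero]
    exact hM.tau_strictMono.monotoneOn (by simp) ⟨h0, h3.le⟩ h0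
  · rw [← hM.tau_one]
    exact hM.tau_strictMono ⟨h0, h3.le⟩ (by simp) h3

lemma Admissible.time_lt_succ (hM : M.Admissible) {N n : ℕ} (h1 : 1 ≤ n) (h2 : n ≤ 2 ^ N) :
    M.time N n < M.time N (n + 1) :=
  hM.tau_strictMono ⟨dyadic_nonneg h1, (dyadic_lt_one h2).le⟩
    ⟨dyadic_nonneg (by lia), dyadic_succ_le_one h2⟩ (dyadic_lt_succ N n)

lemma Admissible.time_le_time (hM : M.Admissible) {N m n : ℕ} (h1 : 1 ≤ m) (hmn : m ≤ n)
    (h2 : n ≤ 2 ^ N) : M.time N m ≤ M.time N n :=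
  hM.tau_strictMono.monotoneOn ⟨dyadic_nonneg h1, (dyadic_lt_one (hmn.trans h2)).le⟩
    ⟨dyadic_nonneg (h1.trans hmn), (dyadic_lt_one h2).le⟩ (dyadic_mono N hmn)

lemma Admissible.C_posDef (hM : M.Admissible) {N n : ℕ} (h1 : 1 ≤ n) (h2 : n ≤ 2 ^ N) :
    (M.C N n).PosDef :=
  hM.CI_posDef.smul (hM.prec_pos _ (hM.time_mem h1 h2))

lemma Admissible.D_posDef (hM : M.Admissible) {N n : ℕ} (h1 : 1 ≤ n) (h2 : n ≤ 2 ^ N) :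
    (M.D N n).PosDef :=
  hM.DZ_posDef.smul (one_div_pos.2 (sub_pos.2 (hM.time_lt_succ h1 h2)))

/-- Only the square of `alpha` enters, so its sign is irrelevant. Definiteness of `E` then comes
from the summand `C⁻¹`. -/
lemma Admissible.demandCov_posSemidef (hM : M.Admissible) {N n : ℕ} (h1 : 1 ≤ n)
    (h2 : n ≤ 2 ^ N) :
    ((1 / M.alpha N n ^ 2) • ((M.C N n)⁻¹ * (M.D N n)⁻¹ * (M.C N n)⁻¹)).PosSemidef :=
  ((hM.D_posDef h1 h2).inv.posSemidef.conj (hM.C_posDef h1 h2).inv.posSemidef).smul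
    (by positivity)

lemma Admissible.E_posDef (hM : M.Admissible) {N n : ℕ} (h1 : 1 ≤ n) (h2 : n ≤ 2 ^ N) :
    (M.E N n).PosDef :=
  ((hM.C_posDef h1 h2).inv.add_posSemidef (hM.demandCov_posSemidef h1 h2)).inv

lemma Admissible.F_posDef (hM : M.Admissible) {N n : ℕ} (h1 : 1 ≤ n) (h2 : n ≤ 2 ^ N) :
    (M.F N n).PosDef := by
  have hE : ∀ k ∈ Finset.Icc 1 n, (M.E N k).PosDef := fun k hk =>
    hM.E_posDef (Finset.mem_Icc.1 hk).1 ((Finset.mem_Icc.1 hk).2.trans h2)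
  rw [F, ← Finset.add_sum_erase _ _ (Finset.mem_Icc.2 ⟨le_rfl, h1⟩)]
  exact (hE 1 (Finset.mem_Icc.2 ⟨le_rfl, h1⟩)).add_posSemidef
    (Matrix.posSemidef_sum _ fun k hk => (hE k (Finset.mem_of_mem_erase hk)).posSemidef)

/-- The variance of the Wiener integral of `√τ'` is the length of the time interval. -/
lemma Admissible.integral_derivWithin_tau (hM : M.Admissible) {a b : ℝ} (ha : 0 ≤ a) (hab : a ≤ b)
    (hb : b ≤ 1)
    (h : MemLp (fun u => Real.sqrt (derivWithin M.tau (Set.Ico 0 1) u)) 2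
      (volume.restrict (Set.Ioc a b))) :
    ∫ u in Set.Ioc a b, Real.sqrt (derivWithin M.tau (Set.Ico 0 1) u) *
      Real.sqrt (derivWithin M.tau (Set.Ico 0 1) u) = M.tau b - M.tau a := by
  have hmono : MonotoneOn M.tau (Set.Ico 0 1) :=
    hM.tau_strictMono.monotoneOn.mono Set.Ico_subset_Icc_self
  have hsq : ∀ u, Real.sqrt (derivWithin M.tau (Set.Ico 0 1) u) *
      Real.sqrt (derivWithin M.tau (Set.Ico 0 1) u) = derivWithin M.tau (Set.Ico 0 1) u := fun u =>
    Real.mul_self_sqrt hmono.derivWithin_nonneg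
  -- Integrability of `τ'` up to `b = 1` comes from the square integrability of `√τ'` contained in
  -- the Wiener integral; `τ` is `C¹` only on `[0,1)`.
  have hint := h.integrable_mul h
  simp only [Pi.mul_def, hsq] at hint
  simp_rw [hsq]
  rw [← intervalIntegral.integral_of_le hab]
  refine intervalIntegral.integral_eq_sub_of_hasDeriv_right_of_le hab
    (hM.tau_cont.mono (Set.Icc_subset_Icc ha hb)) (fun x hx => ?_)
    ((intervalIntegrable_iff_integrableOn_Ioc_of_le hab).2 hint)
  -- At interior points the one-sided notion `derivWithin` is the ordinary derivative.
  have hx' : x ∈ Set.Ioo (0 : ℝ) 1 := ⟨ha.trans_lt hx.1, hx.2.trans_le hb⟩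
  have hd : DifferentiableWithinAt ℝ M.tau (Set.Ico 0 1) x :=
    (hM.tau_C1.differentiableOn (by simp)) x ⟨hx'.1.le, hx'.2⟩
  exact (hd.hasDerivWithinAt.hasDerivAt (Ico_mem_nhds hx'.1 hx'.2)).hasDerivWithinAt

end Deterministic

/-! ### Second moments of the market noise -/

section Noise

variable {Ω : Type*} [MeasurableSpace Ω] {P : Measure Ω} [IsProbabilityMeasure P]

lemma sum_trace_conj_E (Q : Mat d) (N n : ℕ) :
    ∑ m ∈ Finset.Icc 1 n, (Q * M.E N m * Q).trace = (Q * M.F N n * Q).trace := by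
  rw [F, Finset.mul_sum, Finset.sum_mul, Matrix.trace_sum]

/-- Contribution of the private signal noise to the market noise. -/
lemma Admissible.lintegral_sum_Y_le (hM : M.Admissible) {BY : ℝ≥0 → Ω → Vec d}
    (hBY : IsBrownianVec BY P) {N n : ℕ} (hn : n ≤ 2 ^ N) {Q : Mat d} (hQ : Q.PosSemidef) :
    ∫⁻ w, ‖act Q (∑ m ∈ Finset.Icc 1 n, act (M.E N m) (M.Y BY N m w))‖ₑ ^ 2 ∂P
      ≤ ENNReal.ofReal (Q * M.F N n * Q).trace := by
  have hmem : ∀ m ∈ Finset.Icc 1 n, 1 ≤ m ∧ m ≤ 2 ^ N := fun m hm =>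
    ⟨(Finset.mem_Icc.1 hm).1, (Finset.mem_Icc.1 hm).2.trans hn⟩
  have hrw : ∀ w, act Q (∑ m ∈ Finset.Icc 1 n, act (M.E N m) (M.Y BY N m w))
      = ∑ m ∈ Finset.Icc 1 n,
        act (Q * M.E N m * ((Real.sqrt (M.prec (M.time N m)))⁻¹ • invSqrt M.CI))
          (BY (m : ℝ≥0) w - BY ((m - 1 : ℕ) : ℝ≥0) w) := by
    intro w
    simp only [act_sum, Y, act_mul, act_smul_left]
  simp_rw [hrw]
  rw [lintegral_sum_act_of_orthogonal _ (fun (m : ℕ) w => BY (m : ℝ≥0) w - BY ((m - 1 : ℕ) : ℝ≥0) w)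
    _ (fun _ => 1) (fun m _ => (hBY.memLp _).sub (hBY.memLp _))]
  · refine ENNReal.ofReal_le_ofReal ?_
    rw [← sum_trace_conj_E]
    refine Finset.sum_le_sum fun m hm => ?_
    obtain ⟨h1, h2⟩ := hmem m hm
    have hC := hM.C_posDef h1 h2
    have hR := hM.demandCov_posSemidef h1 h2
    have hE : (M.E N m).PosSemidef := (hM.E_posDef h1 h2).posSemidef
    have hp := hM.prec_pos _ (hM.time_mem h1 h2)
    -- `tr(Q E Q)` splits into a private-signal part and a demand part, both nonnegative. The first
    -- is the second moment sought; the second is dropped.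
    have hsplit := trace_conj_inv_add_split hC.inv hR Q
    rw [← E] at hsplit
    have hnn : 0 ≤ (Q * M.E N m * ((1 / M.alpha N m ^ 2) •
        ((M.C N m)⁻¹ * (M.D N m)⁻¹ * (M.C N m)⁻¹)) * M.E N m * Q).trace := by
      have := ((hR.conj hE).conj hQ).trace_nonneg
      simpa only [mul_assoc] using this
    have hCinv : (M.C N m)⁻¹ = (M.prec (M.time N m))⁻¹ • M.CI⁻¹ := by
      rw [C]
      exact Matrix.inv_smul' M.CI (Units.mk0 _ hp.ne') hM.CI_posDef.isUnit_det
    have hA : Q * M.E N m * ((Real.sqrt (M.prec (M.time N m)))⁻¹ • invSqrt M.CI) *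
        (Q * M.E N m * ((Real.sqrt (M.prec (M.time N m)))⁻¹ • invSqrt M.CI))ᵀ
        = Q * M.E N m * (M.C N m)⁻¹ * M.E N m * Q := by
      rw [Matrix.transpose_mul, Matrix.transpose_mul, Matrix.transpose_smul, hQ.transpose_eq,
        hE.transpose_eq, (invSqrt_posSemidef M.CI).transpose_eq, hCinv,
        ← hM.CI_posDef.invSqrt_mul_self]
      have : (M.prec (M.time N m))⁻¹
          = (Real.sqrt (M.prec (M.time N m)))⁻¹ * (Real.sqrt (M.prec (M.time N m)))⁻¹ := by
        rw [← mul_inv, Real.mul_self_sqrt hp.le]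
      rw [this]
      simp only [Matrix.mul_smul, Matrix.smul_mul, smul_smul, mul_assoc]
    rw [hA, one_mul]
    linarith
  · intro m hm k hk i j
    have h1 := hBY.integral_sub_mul_sub (a := ((m - 1 : ℕ) : ℝ≥0)) (b := m)
      (c := ((k - 1 : ℕ) : ℝ≥0)) (e := k) (by simp) (by simp) i j
    simp only [PiLp.sub_apply]
    rw [h1]
    -- Since `m, k ≥ 1`, the truncated subtractions are genuine; after the shift the intervals are
    -- `(m, m+1]` and `(k, k+1]`.
    obtain ⟨m, rfl⟩ := Nat.exists_eq_add_of_le' (hmem m hm).1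
    obtain ⟨k, rfl⟩ := Nat.exists_eq_add_of_le' (hmem k hk).1
    simp only [Nat.add_sub_cancel]
    by_cases hij : i = j
    · simp only [hij, and_true, if_true]
      split_ifs with hmk
      · obtain rfl : m = k := by lia
        simp only [← Set.indicator_mul, mul_one]
        rw [integral_indicator measurableSet_Ioc]
        simp
      · rw [integral_eq_zero_of_ae]
        refine Filter.Eventually.of_forall fun u => ?_
        simp only [Set.indicator_apply, Pi.zero_apply]
        split_ifs with h3 h4 <;> try simp
        rcases Nat.lt_or_gt_of_ne (show m ≠ k by lia) with h | h
        · have : ((m + 1 : ℕ) : ℝ) ≤ k := by exact_mod_cast h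
          have := h3.2; have := h4.1
          push_cast at *
          linarith
        · have : ((k + 1 : ℕ) : ℝ) ≤ m := by exact_mod_cast h
          have := h4.2; have := h3.1
          push_cast at *
          linarith
    · simp [hij]

/-- Contribution of the noise trader demand to the market noise. -/
lemma Admissible.lintegral_sum_Z_le (hM : M.Admissible) {BZ : ℝ≥0 → Ω → Vec d}
    (hBZ : IsBrownianVec BZ P) {N n : ℕ} (hn : n ≤ 2 ^ N) {z : ℕ → Ω → Vec d}
    (hz : ∀ m ∈ Finset.Icc 1 n, M.IsNoiseDemand P BZ N m (z m)) {Q : Mat d} (hQ : Q.PosSemidef) :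
    ∫⁻ w, ‖act Q (∑ m ∈ Finset.Icc 1 n, act (M.E N m)
        ((1 / M.alpha N m) • act (M.C N m)⁻¹ (z m w)))‖ₑ ^ 2 ∂P
      ≤ ENNReal.ofReal (Q * M.F N n * Q).trace := by
  have hmem : ∀ m ∈ Finset.Icc 1 n, 1 ≤ m ∧ m ≤ 2 ^ N := fun m hm =>
    ⟨(Finset.mem_Icc.1 hm).1, (Finset.mem_Icc.1 hm).2.trans hn⟩
  choose! I hI hIz using hz
  -- The demands are identified with Wiener integrals only almost surely, simultaneously for the
  -- finitely many `m`.
  have hrw : (fun w => ‖act Q (∑ m ∈ Finset.Icc 1 n, act (M.E N m)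
        ((1 / M.alpha N m) • act (M.C N m)⁻¹ (z m w)))‖ₑ ^ 2) =ᵐ[P] fun w =>
      ‖∑ m ∈ Finset.Icc 1 n,
        act (Q * M.E N m * ((1 / M.alpha N m) • ((M.C N m)⁻¹ * invSqrt M.DZ))) (I m w)‖ₑ ^ 2 := by
    have := (Filter.eventually_all_finset (l := ae P) (Finset.Icc 1 n)).2 hIz
    filter_upwards [this] with w hw
    congr 2
    rw [act_sum]
    refine Finset.sum_congr rfl fun m hm => ?_
    rw [hw m hm]
    simp only [act_mul, act_smul_left]
  rw [lintegral_congr_ae hrw, lintegral_sum_act_of_orthogonal _ I _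
    (fun m => M.time N (m + 1) - M.time N m) (fun m hm => (hI m hm).2.1)]
  · refine ENNReal.ofReal_le_ofReal ?_
    rw [← sum_trace_conj_E]
    refine Finset.sum_le_sum fun m hm => ?_
    obtain ⟨h1, h2⟩ := hmem m hm
    have hC := hM.C_posDef h1 h2
    have hR := hM.demandCov_posSemidef h1 h2
    have hE : (M.E N m).PosSemidef := (hM.E_posDef h1 h2).posSemidef
    have hΔ := sub_pos.2 (hM.time_lt_succ h1 h2)
    -- The same splitting, now keeping the demand part.
    have hsplit := trace_conj_inv_add_split hC.inv hR Q
    rw [← E] at hsplit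
    have hnn : 0 ≤ (Q * M.E N m * (M.C N m)⁻¹ * M.E N m * Q).trace := by
      have := ((hC.inv.posSemidef.conj hE).conj hQ).trace_nonneg
      simpa only [mul_assoc] using this
    have hDinv : (M.D N m)⁻¹ = (M.time N (m + 1) - M.time N m) • M.DZ⁻¹ := by
      rw [D, one_div]
      have := Matrix.inv_smul' M.DZ (Units.mk0 _ (inv_pos.2 hΔ).ne') hM.DZ_posDef.isUnit_det
      simpa [Units.smul_def] using this
    -- The variance of the Wiener integral is the length of the time interval, which is exactly the
    -- scalar factor of `D⁻¹`.
    have hA : (M.time N (m + 1) - M.time N m) •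
        (Q * M.E N m * ((1 / M.alpha N m) • ((M.C N m)⁻¹ * invSqrt M.DZ)) *
        (Q * M.E N m * ((1 / M.alpha N m) • ((M.C N m)⁻¹ * invSqrt M.DZ)))ᵀ)
        = Q * M.E N m * ((1 / M.alpha N m ^ 2) •
        ((M.C N m)⁻¹ * (M.D N m)⁻¹ * (M.C N m)⁻¹)) * M.E N m * Q := by
      rw [Matrix.transpose_mul, Matrix.transpose_mul, Matrix.transpose_smul, Matrix.transpose_mul,
        hQ.transpose_eq, hE.transpose_eq, (invSqrt_posSemidef M.DZ).transpose_eq,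
        hC.inv.posSemidef.transpose_eq, hDinv, ← hM.DZ_posDef.invSqrt_mul_self]
      simp only [Matrix.mul_smul, Matrix.smul_mul, smul_smul, mul_assoc]
      congr 1
      ring
    rw [← smul_eq_mul, ← Matrix.trace_smul, hA]
    linarith
  · intro m hm k hk i j
    obtain ⟨h1, h2⟩ := hmem m hm
    rw [(hI m hm).integral_mul hBZ (hI k hk)]
    by_cases hij : i = j
    · simp only [hij, and_true, if_true]
      split_ifs with hmk
      · subst hmk
        simp only [← Set.indicator_mul]
        rw [integral_indicator measurableSet_Ioc]
        exact hM.integral_derivWithin_tau (dyadic_nonneg h1) (dyadic_lt_succ N m).le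
          (dyadic_succ_le_one h2) (hI m hm).1
      · rw [integral_eq_zero_of_ae]
        refine Filter.Eventually.of_forall fun u => ?_
        simp only [Set.indicator_apply, Pi.zero_apply]
        split_ifs with h3 h4 <;> try simp
        rcases Nat.lt_or_gt_of_ne hmk with h | h
        · exact absurd h4.1 (not_lt.2 (h3.2.trans (dyadic_mono N h)))
        · exact absurd h3.1 (not_lt.2 (h4.2.trans (dyadic_mono N h)))
    · simp [hij]

end Noise

end MarketData

/-! ### Joint measurability, Grönwall and Jensen inequalities -/

section Paths

/-- A process with measurable marginals and almost surely continuous paths is jointly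
measurable up to a null set. -/
lemma aestronglyMeasurable_of_ae_continuousOn {Ω : Type*} [MeasurableSpace Ω] {P : Measure Ω}
    [SFinite P] {E : Type*} [MeasurableSpace E] [NormedAddCommGroup E] [BorelSpace E]
    [SecondCountableTopology E] {V : ℝ → Ω → E} (hV : ∀ t, Measurable (V t))
    (hc : ∀ᵐ w ∂P, ContinuousOn (fun t => V t w) (Set.Icc 0 1)) :
    AEStronglyMeasurable (fun q : Ω × ℝ => V q.2 q.1)
      (P.prod (volume.restrict (Set.Icc 0 1))) := by
  classical
  obtain ⟨S, hSsub, hSm, hS0⟩ := exists_measurable_superset_of_null hc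
  have hcS : ∀ w ∉ S, ContinuousOn (fun t => V t w) (Set.Icc 0 1) := fun w hw => by
    by_contra h
    exact hw (hSsub h)
  -- Zero on the null set of bad paths and frozen outside `[0,1]`: every path of this modification
  -- is continuous on all of `ℝ`.
  let V' : ℝ → Ω → E := fun t => Set.indicator Sᶜ (V (Set.projIcc (0 : ℝ) 1 zero_le_one t))
  have hm : Measurable (Function.uncurry V') := by
    refine measurable_uncurry_of_continuous_of_measurable (fun w => ?_)
      fun t => (hV _).indicator hSm.compl
    by_cases hw : w ∈ S
    · simpa [V', hw] using continuous_const
    · simp only [V', Set.indicator_of_mem (show w ∈ Sᶜ from hw)]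
      exact (hcS w hw).comp_continuous (continuous_subtype_val.comp continuous_projIcc)
        fun t => (Set.projIcc (0 : ℝ) 1 zero_le_one t).2
  refine ⟨fun q => V' q.2 q.1, (hm.comp measurable_swap).stronglyMeasurable, ?_⟩
  have h1 : ∀ᵐ q ∂(P.prod (volume.restrict (Set.Icc (0 : ℝ) 1))), q.1 ∉ S :=
    Measure.quasiMeasurePreserving_fst.ae (measure_eq_zero_iff_ae_notMem.1 hS0)
  have h2 : ∀ᵐ q ∂(P.prod (volume.restrict (Set.Icc (0 : ℝ) 1))), q.2 ∈ Set.Icc (0 : ℝ) 1 :=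
    Measure.quasiMeasurePreserving_snd.ae (ae_restrict_mem measurableSet_Icc)
  filter_upwards [h1, h2] with q hq1 hq2
  simp [V', hq1, Set.projIcc_of_mem _ hq2]

/-- Grönwall's inequality in integral form on `[0,1]`. -/
lemma le_add_integral_of_le_add_integral {g h : ℝ → ℝ} {k : ℝ} (hk : 0 ≤ k)
    (hg : ContinuousOn g (Set.Icc 0 1)) (hh : ContinuousOn h (Set.Icc 0 1))
    (hh0 : ∀ t ∈ Set.Icc (0 : ℝ) 1, 0 ≤ h t)
    (hle : ∀ t ∈ Set.Icc (0 : ℝ) 1, g t ≤ h t + k * ∫ s in (0 : ℝ)..t, g s) :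
    ∀ t ∈ Set.Icc (0 : ℝ) 1, g t ≤ h t + k * Real.exp k * ∫ s in (0 : ℝ)..1, h s := by
  have hint : ∀ {f : ℝ → ℝ}, ContinuousOn f (Set.Icc 0 1) → ∀ a ∈ Set.Icc (0 : ℝ) 1,
      ∀ b ∈ Set.Icc (0 : ℝ) 1, IntervalIntegrable f volume a b := fun hf a ha b hb =>
    (hf.mono (Set.uIcc_subset_Icc ha hb)).intervalIntegrable
  have hprim : ∀ {f : ℝ → ℝ}, ContinuousOn f (Set.Icc 0 1) → ∀ x ∈ Set.Ioo (0 : ℝ) 1,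
      HasDerivAt (fun t => ∫ s in (0 : ℝ)..t, f s) (f x) x := fun {f} hf x hx => by
    have hx' : x ∈ Set.Icc (0 : ℝ) 1 := ⟨hx.1.le, hx.2.le⟩
    refine intervalIntegral.integral_hasDerivAt_right (hint hf 0 (by simp) x hx') ?_
      (hf.continuousAt (Icc_mem_nhds hx.1 hx.2))
    exact (hf.mono Set.Ioo_subset_Icc_self).stronglyMeasurableAtFilter isOpen_Ioo x hx
  have hcont : ∀ {f : ℝ → ℝ}, ContinuousOn f (Set.Icc 0 1) →
      ContinuousOn (fun t => ∫ s in (0 : ℝ)..t, f s) (Set.Icc 0 1) := fun {f} hf => by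
    have := intervalIntegral.continuousOn_primitive_interval (μ := volume) (f := f) (a := 0)
      (b := 1) (by rw [Set.uIcc_of_le zero_le_one]; exact hf.integrableOn_Icc)
    rwa [Set.uIcc_of_le zero_le_one] at this
  -- By hypothesis `φ' = e^{-kx}(g - k∫g) - h ≤ (e^{-kx} - 1) h ≤ 0`, and `φ 0 = 0`.
  let φ : ℝ → ℝ := fun t => Real.exp (-(k * t)) * (∫ s in (0 : ℝ)..t, g s) - ∫ s in (0 : ℝ)..t, h s
  have hφ : AntitoneOn φ (Set.Icc 0 1) := by
    have hd : ∀ x ∈ Set.Ioo (0 : ℝ) 1, HasDerivAt φ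
        (Real.exp (-(k * x)) * (-(k * 1)) * (∫ s in (0 : ℝ)..x, g s)
          + Real.exp (-(k * x)) * g x - h x) x := fun x hx =>
      (((((hasDerivAt_id x).const_mul k).neg).exp).mul (hprim hg x hx)).sub (hprim hh x hx)
    refine antitoneOn_of_deriv_nonpos (convex_Icc 0 1) ?_ ?_ ?_
    · exact ((by fun_prop : Continuous fun t => Real.exp (-(k * t))).continuousOn.mul
        (hcont hg)).sub (hcont hh)
    · rw [interior_Icc]
      exact fun x hx => (hd x hx).differentiableAt.differentiableWithinAt
    · rw [interior_Icc]
      intro x hx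
      rw [(hd x hx).deriv]
      have hx' : x ∈ Set.Icc (0 : ℝ) 1 := ⟨hx.1.le, hx.2.le⟩
      have h1 := hle x hx'
      have h2 := hh0 x hx'
      have h3 : Real.exp (-(k * x)) ≤ 1 := Real.exp_le_one_iff.2 (by have := hx.1; nlinarith)
      have h4 := Real.exp_pos (-(k * x))
      nlinarith [mul_le_mul_of_nonneg_left h1 h4.le, mul_le_mul_of_nonneg_right h3 h2]
  intro t ht
  have h1 : φ t ≤ 0 := by
    have := hφ (show (0 : ℝ) ∈ Set.Icc 0 1 by simp) ht ht.1
    simpa [φ] using this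
  have h2 : ∫ s in (0 : ℝ)..t, h s ≤ ∫ s in (0 : ℝ)..1, h s := by
    refine intervalIntegral.integral_mono_interval le_rfl ht.1 ht.2 ?_
      (hint hh 0 (by simp) 1 (by simp))
    filter_upwards [ae_restrict_mem measurableSet_Ioc] with s hs
    exact hh0 s ⟨hs.1.le, hs.2⟩
  have h0 : 0 ≤ ∫ s in (0 : ℝ)..1, h s :=
    intervalIntegral.integral_nonneg zero_le_one hh0
  have h3 : ∫ s in (0 : ℝ)..t, g s ≤ Real.exp k * ∫ s in (0 : ℝ)..1, h s := by
    have h4 : Real.exp (-(k * t)) * (∫ s in (0 : ℝ)..t, g s) ≤ ∫ s in (0 : ℝ)..1, h s := by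
      have : φ t = Real.exp (-(k * t)) * (∫ s in (0 : ℝ)..t, g s) - ∫ s in (0 : ℝ)..t, h s := rfl
      linarith
    have h5 : ∫ s in (0 : ℝ)..t, g s ≤ Real.exp (k * t) * ∫ s in (0 : ℝ)..1, h s := by
      have := mul_le_mul_of_nonneg_left h4 (Real.exp_pos (k * t)).le
      rwa [← mul_assoc, ← Real.exp_add, add_neg_cancel, Real.exp_zero, one_mul] at this
    refine h5.trans (mul_le_mul_of_nonneg_right (Real.exp_le_exp.2 ?_) h0)
    have := ht.2
    nlinarith
  have := hle t ht
  nlinarith [mul_le_mul_of_nonneg_left h3 hk]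

lemma sq_integral_le_integral_sq {h : ℝ → ℝ} (hh : ContinuousOn h (Set.Icc 0 1)) :
    (∫ s in (0 : ℝ)..1, h s) ^ 2 ≤ ∫ s in (0 : ℝ)..1, h s ^ 2 := by
  have hu : Set.uIcc (0 : ℝ) 1 = Set.Icc 0 1 := Set.uIcc_of_le zero_le_one
  have i1 : IntervalIntegrable h volume 0 1 := ContinuousOn.intervalIntegrable (by rwa [hu])
  have i2 : IntervalIntegrable (fun s => h s ^ 2) volume 0 1 :=
    ContinuousOn.intervalIntegrable (by rw [hu]; exact hh.pow 2)
  set c := ∫ s in (0 : ℝ)..1, h s with hc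
  -- The integrand is `(h - c)²` with `c` the mean of `h` over an interval of length one.
  have h0 : 0 ≤ ∫ s in (0 : ℝ)..1, (h s ^ 2 - 2 * c * h s + c ^ 2) :=
    intervalIntegral.integral_nonneg zero_le_one fun s _ => by nlinarith [sq_nonneg (h s - c)]
  rw [intervalIntegral.integral_add (i2.sub (i1.const_mul _)) (by simp),
    intervalIntegral.integral_sub i2 (i1.const_mul _), intervalIntegral.integral_const_mul,
    ← hc] at h0
  simp at h0
  nlinarith

end Paths

/-! ### `L²` bound for the Ornstein–Uhlenbeck process -/

section Moments

variable {Ω : Type*} [MeasurableSpace Ω] {P : Measure Ω} {d : ℕ}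

lemma IsBrownianVec.ae_continuous {W : ℝ≥0 → Ω → Vec d} (hW : IsBrownianVec W P) :
    ∀ᵐ w ∂P, Continuous fun t => W t w := by
  filter_upwards [ae_all_iff.2 fun i => (hW.coord i).cont] with w hw
  exact (PiLp.continuous_toLp 2 _).comp (continuous_pi hw)

lemma IsBrownianVec.lintegral_act [IsProbabilityMeasure P] {W : ℝ≥0 → Ω → Vec d} (hW : IsBrownianVec W P) (A : Mat d)
    (t : ℝ≥0) :
    ∫⁻ w, ‖act A (W t w)‖ₑ ^ 2 ∂P = ENNReal.ofReal (t * (A * Aᵀ).trace) := by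
  have := lintegral_sum_act_of_orthogonal (P := P) {()} (fun _ => W t) (fun _ => A)
    (fun _ => (t : ℝ)) (fun _ _ => hW.memLp t) (fun _ _ _ _ i j => by
      rw [hW.integral_mul]; simp)
  simpa using this

lemma enorm_sq_eq_ofReal {E : Type*} [SeminormedAddCommGroup E] (v : E) :
    ‖v‖ₑ ^ 2 = ENNReal.ofReal (‖v‖ ^ 2) := by
  rw [← ofReal_norm, ENNReal.ofReal_pow (norm_nonneg _)]

/-- Pathwise bound of the Ornstein-Uhlenbeck process by its driving noise. -/
lemma MarketData.IsOU.ae_norm_le {M : MarketData d} {B : ℝ≥0 → Ω → Vec d} {X : ℝ → Ω → Vec d}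
    (hX : M.IsOU P B X) (hB : IsBrownianVec B P) :
    ∃ a k : ℝ, 0 ≤ a ∧ 0 ≤ k ∧ ∀ᵐ w ∂P,
      ContinuousOn (fun s : ℝ => a + ‖act M.sigma (B s.toNNReal w)‖) (Set.Icc 0 1) ∧
      ∀ t ∈ Set.Icc (0 : ℝ) 1, ‖X t w‖ ≤ a + ‖act M.sigma (B t.toNNReal w)‖ +
        k * ∫ s in (0 : ℝ)..1, (a + ‖act M.sigma (B s.toNNReal w)‖) := by
  set k := ‖Matrix.toEuclideanCLM (𝕜 := ℝ) M.kappa‖ with hk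
  have hk0 : 0 ≤ k := norm_nonneg _
  refine ⟨‖M.x₀‖ + k * ‖M.level‖, k * Real.exp k, by positivity, by positivity, ?_⟩
  filter_upwards [hX.cont, hX.sde, hB.ae_continuous] with w hc hs hBc
  have hcont : ContinuousOn (fun s : ℝ => ‖M.x₀‖ + k * ‖M.level‖ +
      ‖act M.sigma (B s.toNNReal w)‖) (Set.Icc 0 1) := by
    refine (continuous_const.add (Continuous.norm ?_)).continuousOn
    exact (Matrix.toEuclideanCLM (𝕜 := ℝ) M.sigma).continuous.comp
      (hBc.comp continuous_real_toNNReal)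
  refine ⟨hcont, ?_⟩
  refine le_add_integral_of_le_add_integral hk0 hc.norm hcont (fun t _ => by positivity)
    fun t ht => ?_
  have hu : Set.uIcc (0 : ℝ) t ⊆ Set.Icc 0 1 := Set.uIcc_subset_Icc (by simp) ht
  have i1 : IntervalIntegrable (fun s => ‖X s w‖) volume 0 t :=
    (hc.norm.mono hu).intervalIntegrable
  have h1 : ‖∫ s in (0 : ℝ)..t, act M.kappa (M.level - X s w)‖
      ≤ ∫ s in (0 : ℝ)..t, (k * ‖M.level‖ + k * ‖X s w‖) := by
    refine intervalIntegral.norm_integral_le_of_norm_le ht.1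
      (Filter.Eventually.of_forall fun s _ => ?_) (intervalIntegrable_const.add (i1.const_mul k))
    have := norm_sub_le M.level (X s w)
    calc ‖act M.kappa (M.level - X s w)‖ ≤ k * ‖M.level - X s w‖ := norm_act_le _ _
      _ ≤ _ := by nlinarith
  rw [intervalIntegral.integral_add (by simp) (i1.const_mul k),
    intervalIntegral.integral_const, intervalIntegral.integral_const_mul, sub_zero,
    smul_eq_mul] at h1
  have h2 : t * (k * ‖M.level‖) ≤ k * ‖M.level‖ :=
    mul_le_of_le_one_left (by positivity) ht.2
  have h3 := norm_add_le (M.x₀ + ∫ s in (0 : ℝ)..t, act M.kappa (M.level - X s w))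
    (act M.sigma (B t.toNNReal w))
  have h4 := norm_add_le M.x₀ (∫ s in (0 : ℝ)..t, act M.kappa (M.level - X s w))
  rw [hs t ht]
  linarith

/-- The Ornstein-Uhlenbeck process is bounded in `L²`. -/
lemma MarketData.IsOU.exists_lintegral_le [IsProbabilityMeasure P] {M : MarketData d} {B : ℝ≥0 → Ω → Vec d}
    {X : ℝ → Ω → Vec d} (hX : M.IsOU P B X) (hB : IsBrownianVec B P) :
    ∃ K : ℝ≥0∞, K ≠ ∞ ∧ ∀ t ∈ Set.Icc (0 : ℝ) 1, ∫⁻ w, ‖X t w‖ₑ ^ 2 ∂P ≤ K := by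
  obtain ⟨a, k, ha, hk, hae⟩ := hX.ae_norm_le hB
  set h : ℝ → Ω → ℝ := fun s w => a + ‖act M.sigma (B s.toNNReal w)‖ with hh
  have hhm : ∀ s, Measurable (h s) := fun s =>
    measurable_const.add (((Matrix.toEuclideanCLM (𝕜 := ℝ) M.sigma).measurable.comp
      (hB.measurable _)).norm)
  have hjoint := aestronglyMeasurable_of_ae_continuousOn hhm (hae.mono fun w hw => hw.1)
  -- From `(a + b)² ≤ 2a² + 2b²` and `E‖σ B_s‖² = s tr(σσ') ≤ tr(σσ')`.
  set K₀ : ℝ≥0∞ := ENNReal.ofReal (2 * a ^ 2) +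
    ENNReal.ofReal 2 * ENNReal.ofReal (M.sigma * M.sigmaᵀ).trace with hK₀
  have hK₀top : K₀ ≠ ∞ := ENNReal.add_ne_top.2 ⟨ENNReal.ofReal_ne_top,
    ENNReal.mul_ne_top ENNReal.ofReal_ne_top ENNReal.ofReal_ne_top⟩
  have hEh : ∀ s ∈ Set.Icc (0 : ℝ) 1, ∫⁻ w, ENNReal.ofReal (h s w ^ 2) ∂P ≤ K₀ := by
    intro s hs
    have htr : 0 ≤ (M.sigma * M.sigmaᵀ).trace := by
      rw [trace_mul_transpose_eq]; positivity
    calc ∫⁻ w, ENNReal.ofReal (h s w ^ 2) ∂P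
        ≤ ∫⁻ w, (ENNReal.ofReal (2 * a ^ 2) + ENNReal.ofReal 2 * ‖act M.sigma (B s.toNNReal w)‖ₑ ^ 2) ∂P := by
          refine lintegral_mono fun w => ?_
          rw [enorm_sq_eq_ofReal,
            ← ENNReal.ofReal_mul (by norm_num), ← ENNReal.ofReal_add (by positivity) (by positivity)]
          refine ENNReal.ofReal_le_ofReal ?_
          simp only [hh]
          nlinarith [sq_nonneg (a - ‖act M.sigma (B s.toNNReal w)‖)]
      _ ≤ K₀ := by
          rw [lintegral_add_left measurable_const, lintegral_const_mul' _ _ (by simp),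
            hB.lintegral_act]
          simp only [lintegral_const, measure_univ, mul_one, hK₀]
          gcongr
          refine mul_le_of_le_one_left htr ?_
          simpa using hs.2
  refine ⟨ENNReal.ofReal 2 * K₀ + ENNReal.ofReal (2 * k ^ 2) * K₀, ENNReal.add_ne_top.2
    ⟨ENNReal.mul_ne_top ENNReal.ofReal_ne_top hK₀top, ENNReal.mul_ne_top ENNReal.ofReal_ne_top hK₀top⟩, ?_⟩
  intro t ht
  have hswap : ∫⁻ w, (∫⁻ s in Set.Icc (0 : ℝ) 1, ENNReal.ofReal (h s w ^ 2)) ∂P ≤ K₀ := by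
    rw [lintegral_lintegral_swap
      (f := fun w s => ENNReal.ofReal (h s w ^ 2)) (hjoint.aemeasurable.pow_const 2).ennreal_ofReal]
    calc ∫⁻ s in Set.Icc (0 : ℝ) 1, (∫⁻ w, ENNReal.ofReal (h s w ^ 2) ∂P)
        ≤ ∫⁻ s in Set.Icc (0 : ℝ) 1, K₀ := setLIntegral_mono measurable_const hEh
      _ = K₀ := by simp
  calc ∫⁻ w, ‖X t w‖ₑ ^ 2 ∂P
      ≤ ∫⁻ w, (ENNReal.ofReal 2 * ENNReal.ofReal (h t w ^ 2) + ENNReal.ofReal (2 * k ^ 2) *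
          ∫⁻ s in Set.Icc (0 : ℝ) 1, ENNReal.ofReal (h s w ^ 2)) ∂P := by
        refine lintegral_mono_ae ?_
        filter_upwards [hae] with w hw
        have hcs := sq_integral_le_integral_sq hw.1
        have hI : ∫⁻ s in Set.Icc (0 : ℝ) 1, ENNReal.ofReal (h s w ^ 2)
            = ENNReal.ofReal (∫ s in (0 : ℝ)..1, h s w ^ 2) := by
          rw [intervalIntegral.integral_of_le zero_le_one, ← integral_Icc_eq_integral_Ioc,
            ofReal_integral_eq_lintegral_ofReal]
          · exact (hw.1.pow 2).integrableOn_Icc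
          · exact Filter.Eventually.of_forall fun s => by positivity
        have hX0 := norm_nonneg (X t w)
        have hXle := hw.2 t ht
        rw [hI, enorm_sq_eq_ofReal,
          ← ENNReal.ofReal_mul (by norm_num), ← ENNReal.ofReal_mul (by positivity),
          ← ENNReal.ofReal_add (by positivity)
            (mul_nonneg (by positivity) ((sq_nonneg _).trans hcs))]
        refine ENNReal.ofReal_le_ofReal ?_
        set J := ∫ s in (0 : ℝ)..1, (a + ‖act M.sigma (B s.toNNReal w)‖)
        have e1 : ‖X t w‖ ^ 2 ≤ (h t w + k * J) ^ 2 := pow_le_pow_left₀ hX0 hXle 2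
        have e2 : k ^ 2 * J ^ 2 ≤ k ^ 2 * ∫ s in (0 : ℝ)..1, h s w ^ 2 :=
          mul_le_mul_of_nonneg_left hcs (sq_nonneg k)
        nlinarith [sq_nonneg (h t w - k * J)]
    _ ≤ ENNReal.ofReal 2 * K₀ + ENNReal.ofReal (2 * k ^ 2) * K₀ := by
        rw [lintegral_add_left (((hhm t).pow_const 2).ennreal_ofReal.const_mul _),
          lintegral_const_mul' _ _ ENNReal.ofReal_ne_top,
          lintegral_const_mul' _ _ ENNReal.ofReal_ne_top]
        gcongr
        exact hEh t ht

end Moments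

/-! ### Uniform bounds for the drift of one insider -/

namespace MarketData

variable {d : ℕ} {M : MarketData d}

section Bounds

lemma Admissible.condCov_posDef (hM : M.Admissible) {t u : ℝ} (ht : t < 1)
    (hu : u ∈ Set.Icc 0 t) : (M.condCov (1 - u)).PosDef :=
  M.condCov_posDef hM.invertible (by linarith [hu.2])

/-- By Cramer's rule, since the determinant of the covariance does not vanish on `[0,t]`; at `u = 1`
the covariance degenerates, whence `t < 1`. -/
lemma Admissible.continuousOn_condPrec (hM : M.Admissible) {t : ℝ} (ht : t < 1) :
    ContinuousOn (fun u => M.condPrec (1 - u)) (Set.Icc 0 t) := by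
  have hc : Continuous fun u => M.condCov (1 - u) :=
    M.continuous_condCov.comp (by fun_prop)
  simp only [condPrec, Matrix.inv_def, Ring.inverse_eq_inv']
  exact (hc.matrix_det.continuousOn.inv₀ fun u hu =>
    (hM.condCov_posDef ht hu).det_pos.ne').smul hc.matrix_adjugate.continuousOn

lemma Admissible.condPrec_posDef (hM : M.Admissible) {t u : ℝ} (ht : t < 1)
    (hu : u ∈ Set.Icc 0 t) : (M.condPrec (1 - u)).PosDef :=
  (hM.condCov_posDef ht hu).inv

lemma Admissible.condPrec_inv (hM : M.Admissible) {t u : ℝ} (ht : t < 1)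
    (hu : u ∈ Set.Icc 0 t) : (M.condPrec (1 - u))⁻¹ = M.condCov (1 - u) :=
  Matrix.nonsing_inv_nonsing_inv _ (hM.condCov_posDef ht hu).isUnit_det

variable (M) in
/-- The matrix `σ' e^{-(1-t)κ'} P(1-t)`. -/
noncomputable def driftGain (u : ℝ) : Mat d :=
  M.sigmaᵀ * NormedSpace.exp (-((1 - u) • M.kappaᵀ)) * M.condPrec (1 - u)

lemma Admissible.continuousOn_driftGain (hM : M.Admissible) {t : ℝ} (ht : t < 1) :
    ContinuousOn M.driftGain (Set.Icc 0 t) := by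
  have h1 : Continuous fun u : ℝ => M.sigmaᵀ * NormedSpace.exp (-((1 - u) • M.kappaᵀ)) :=
    continuous_const.matrix_mul ((continuous_exp_neg_smul M.kappaᵀ).comp
      (continuous_const.sub continuous_id))
  exact h1.continuousOn.mul (hM.continuousOn_condPrec ht)

lemma continuous_toEuclideanCLM :
    Continuous (fun A : Mat d => Matrix.toEuclideanCLM (𝕜 := ℝ) A) :=
  LinearMap.continuous_of_finiteDimensional
    (Matrix.toEuclideanCLM (𝕜 := ℝ) (n := Fin d)).toAlgEquiv.toLinearMap

/-- A common bound on `[0,t]` for all time dependent coefficients of the information drift. -/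
lemma Admissible.exists_bound (hM : M.Admissible) {t : ℝ} (ht : t < 1) :
    ∃ K : ℝ, 1 ≤ K ∧ ∀ u ∈ Set.Icc 0 t,
      ‖Matrix.toEuclideanCLM (𝕜 := ℝ) (M.driftGain u)‖ ≤ K ∧
      ‖Matrix.toEuclideanCLM (𝕜 := ℝ) (M.condPrec (1 - u))‖ ≤ K ∧
      ‖Matrix.toEuclideanCLM (𝕜 := ℝ) (NormedSpace.exp (-((1 - u) • M.kappa)))‖ ≤ K ∧
      (M.condCov (1 - u)).trace ≤ K := by
  have hcomp : IsCompact (Set.Icc 0 t) := isCompact_Icc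
  obtain ⟨k1, h1⟩ := hcomp.exists_bound_of_continuousOn
    (continuous_toEuclideanCLM.comp_continuousOn (hM.continuousOn_driftGain ht))
  obtain ⟨k2, h2⟩ := hcomp.exists_bound_of_continuousOn
    (continuous_toEuclideanCLM.comp_continuousOn (hM.continuousOn_condPrec ht))
  obtain ⟨k3, h3⟩ := hcomp.exists_bound_of_continuousOn
    (continuous_toEuclideanCLM.comp ((continuous_exp_neg_smul M.kappa).comp
      (continuous_const.sub continuous_id : Continuous fun u : ℝ => 1 - u))).continuousOn
  obtain ⟨k4, h4⟩ := hcomp.exists_bound_of_continuousOn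
    ((M.continuous_condCov.comp
      (continuous_const.sub continuous_id : Continuous fun u : ℝ => 1 - u)).matrix_trace).continuousOn
  -- Including `1` lets a higher power of the bound absorb lower ones.
  refine ⟨max 1 (max (max k1 k2) (max k3 k4)), le_max_left _ _, fun u hu => ?_⟩
  refine ⟨(h1 u hu).trans (by simp), (h2 u hu).trans (by simp), (h3 u hu).trans (by simp),
    ((le_abs_self _).trans (h4 u hu)).trans (by simp)⟩

end Bounds

section Drift

variable {Ω : Type*} {BY : ℝ≥0 → Ω → Vec d} {X : ℝ → Ω → Vec d} {Z : ℕ → ℕ → Ω → Vec d}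

/-- The information drift in terms of the fundamental innovation and the market noise. -/
lemma Admissible.driftAt_J_eq (hM : M.Admissible) {N n : ℕ} (h1 : 1 ≤ n) (h2 : n ≤ 2 ^ N)
    (u : ℝ) (w : Ω) :
    M.driftAt X N n u w (M.J BY X Z N n w)
      = act (M.driftGain u)
          (act ((M.condPrec (1 - u) + M.F N n)⁻¹ * M.F N n)
              (X 1 w - M.condMean (X u w) (1 - u))
            + act (M.condPrec (1 - u) + M.F N n)⁻¹
              (∑ m ∈ Finset.Icc 1 n, act (M.E N m) (M.Y BY N m w))
            + act (M.condPrec (1 - u) + M.F N n)⁻¹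
              (∑ m ∈ Finset.Icc 1 n, act (M.E N m)
                ((1 / M.alpha N m) • act (M.C N m)⁻¹ (Z N m w)))) := by
  have hFJ : act (M.F N n) (M.J BY X Z N n w)
      = act (M.F N n) (X 1 w) + (∑ m ∈ Finset.Icc 1 n, act (M.E N m) (M.Y BY N m w))
        + ∑ m ∈ Finset.Icc 1 n, act (M.E N m)
          ((1 / M.alpha N m) • act (M.C N m)⁻¹ (Z N m w)) := by
    rw [J, ← act_mul, Matrix.mul_nonsing_inv _ (hM.F_posDef h1 h2).isUnit_det, act_one, F,
      act_sum_left, ← Finset.sum_add_distrib, ← Finset.sum_add_distrib]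
    simp only [H, G, act_add]
  rw [driftAt, mul_assoc, act_mul]
  change act (M.driftGain u) _ = _
  rw [act_mul, act_sub, hFJ, act_mul, act_sub]
  simp only [act_add, act_sub, add_sub_right_comm]

/-- A pathwise estimate in which `F` survives only inside the two noise terms, whose second moments
are bounded uniformly in `F`. -/
lemma Admissible.norm_driftAt_J_le (hM : M.Admissible) {t u K : ℝ} (ht : t < 1)
    (hu : u ∈ Set.Icc 0 t) (hK : 1 ≤ K)
    (hK1 : ‖Matrix.toEuclideanCLM (𝕜 := ℝ) (M.driftGain u)‖ ≤ K)
    (hK2 : ‖Matrix.toEuclideanCLM (𝕜 := ℝ) (M.condPrec (1 - u))‖ ≤ K)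
    (hK3 : ‖Matrix.toEuclideanCLM (𝕜 := ℝ) (NormedSpace.exp (-((1 - u) • M.kappa)))‖ ≤ K)
    (hK4 : (M.condCov (1 - u)).trace ≤ K) {N n : ℕ} (h1 : 1 ≤ n) (h2 : n ≤ 2 ^ N) (w : Ω) :
    ‖M.driftAt X N n u w (M.J BY X Z N n w)‖
      ≤ 4 * K ^ 4 * (‖X 1 w‖ + ‖X u w‖ + ‖M.level‖
        + ‖act (M.condPrec (1 - u) + M.F N n)⁻¹
            (∑ m ∈ Finset.Icc 1 n, act (M.E N m) (M.Y BY N m w))‖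
        + ‖act (M.condPrec (1 - u) + M.F N n)⁻¹ (∑ m ∈ Finset.Icc 1 n, act (M.E N m)
            ((1 / M.alpha N m) • act (M.C N m)⁻¹ (Z N m w)))‖) := by
  have hPd := hM.condPrec_posDef ht hu
  have hF := (hM.F_posDef h1 h2).posSemidef
  have hK0 : 0 ≤ K := by linarith
  rw [hM.driftAt_J_eq h1 h2, hPd.inv_add_mul hF]
  have hQ := (hPd.add_posSemidef hF).inv.posSemidef
  have htr : (M.condPrec (1 - u) + M.F N n)⁻¹.trace ≤ K := by
    refine (hPd.trace_inv_add_le hF).trans ?_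
    rwa [hM.condPrec_inv ht hu]
  set Q := (M.condPrec (1 - u) + M.F N n)⁻¹
  set SY := act Q (∑ m ∈ Finset.Icc 1 n, act (M.E N m) (M.Y BY N m w))
  set SZ := act Q (∑ m ∈ Finset.Icc 1 n, act (M.E N m)
            ((1 / M.alpha N m) • act (M.C N m)⁻¹ (Z N m w)))
  -- Operator norm ≤ Frobenius norm ≤ trace ≤ `K`, for positive semidefinite `Q`.
  have hQle : ∀ v, ‖act Q v‖ ≤ K * ‖v‖ := fun v => by
    refine abs_le_of_sq_le_sq' ?_ (by positivity) |>.2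
    calc ‖act Q v‖ ^ 2 ≤ (Q * Qᵀ).trace * ‖v‖ ^ 2 := norm_act_sq_le_trace Q v
      _ ≤ Q.trace ^ 2 * ‖v‖ ^ 2 := by gcongr; exact hQ.trace_mul_transpose_le
      _ ≤ K ^ 2 * ‖v‖ ^ 2 := by gcongr; exact hQ.trace_nonneg
      _ = (K * ‖v‖) ^ 2 := by ring
  set v := X 1 w - M.condMean (X u w) (1 - u) with hv
  have hvle : ‖v‖ ≤ K * (‖X 1 w‖ + ‖X u w‖ + 2 * ‖M.level‖) := by
    have e1 : ‖v‖ ≤ ‖X 1 w‖ + ‖M.condMean (X u w) (1 - u)‖ := norm_sub_le _ _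
    have e2 : ‖M.condMean (X u w) (1 - u)‖ ≤ ‖M.level‖ + K * (‖X u w‖ + ‖M.level‖) := by
      refine (norm_add_le _ _).trans ?_
      gcongr
      refine (norm_act_le _ _).trans ?_
      gcongr
      exact norm_sub_le _ _
    have e3 : ‖X 1 w‖ ≤ K * ‖X 1 w‖ := le_mul_of_one_le_left (norm_nonneg _) hK
    have e4 : ‖M.level‖ ≤ K * ‖M.level‖ := le_mul_of_one_le_left (norm_nonneg _) hK
    linarith
  have hQF : ‖act (1 - Q * M.condPrec (1 - u)) v‖ ≤ 2 * K ^ 2 * ‖v‖ := by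
    rw [act_sub_left, act_one, act_mul]
    have e1 : ‖act Q (act (M.condPrec (1 - u)) v)‖ ≤ K * (K * ‖v‖) := by
      refine (hQle _).trans ?_
      gcongr
      refine (norm_act_le _ _).trans ?_
      gcongr
    have e2 : 1 * ‖v‖ ≤ K ^ 2 * ‖v‖ := by gcongr; exact one_le_pow₀ hK
    have := norm_sub_le v (act Q (act (M.condPrec (1 - u)) v))
    linarith
  -- `4 K⁴` is the coefficient of `‖M.level‖` below; it dominates the other coefficients `2 K⁴` and
  -- `K`.
  have hK4' : K ≤ 4 * K ^ 4 := by
    have : K ^ 1 ≤ K ^ 4 := pow_le_pow_right₀ hK (by norm_num)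
    have : 0 ≤ K ^ 4 := by positivity
    linarith
  calc ‖act (M.driftGain u) (act (1 - Q * M.condPrec (1 - u)) v + SY + SZ)‖
      ≤ K * ‖act (1 - Q * M.condPrec (1 - u)) v + SY + SZ‖ := by
        refine (norm_act_le _ _).trans ?_
        gcongr
    _ ≤ K * (2 * K ^ 2 * (K * (‖X 1 w‖ + ‖X u w‖ + 2 * ‖M.level‖)) + ‖SY‖ + ‖SZ‖) := by
        gcongr
        refine (norm_add₃_le).trans ?_
        gcongr
        refine hQF.trans ?_
        gcongr
    _ = 2 * K ^ 4 * (‖X 1 w‖ + ‖X u w‖) + 4 * K ^ 4 * ‖M.level‖ + K * ‖SY‖ + K * ‖SZ‖ := by ring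
    _ ≤ 4 * K ^ 4 * (‖X 1 w‖ + ‖X u w‖) + 4 * K ^ 4 * ‖M.level‖ + 4 * K ^ 4 * ‖SY‖
          + 4 * K ^ 4 * ‖SZ‖ := by
        gcongr
        norm_num
    _ = _ := by ring

lemma measurable_Y [MeasurableSpace Ω] (hBY : ∀ s, Measurable (BY s)) (N n : ℕ) :
    Measurable (M.Y BY N n) :=
  ((Matrix.toEuclideanCLM (𝕜 := ℝ) (invSqrt M.CI)).measurable.comp
    ((hBY n).sub (hBY (n - 1 : ℕ)))).const_smul (Real.sqrt (M.prec (M.time N n)))⁻¹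

/-- For a fixed time the drift of a single insider is bounded in `L²`, uniformly in the market. -/
lemma Admissible.exists_lintegral_driftAt_le [MeasurableSpace Ω] {P : Measure Ω}
    [IsProbabilityMeasure P] (hM : M.Admissible) {B BZ : ℝ≥0 → Ω → Vec d}
    (hB : IsBrownianVec B P) (hBY : IsBrownianVec BY P) (hBZ : IsBrownianVec BZ P)
    (hX : M.IsOU P B X)
    (hZ : ∀ N n : ℕ, 1 ≤ N → 1 ≤ n → n ≤ 2 ^ N → M.IsNoiseDemand P BZ N n (Z N n))
    {t : ℝ} (ht : t < 1) :
    ∃ K : ℝ≥0∞, K ≠ ∞ ∧ ∀ N n : ℕ, 1 ≤ N → 1 ≤ n → n ≤ 2 ^ N → ∀ u ∈ Set.Icc 0 t,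
      ∫⁻ w, ‖M.driftAt X N n u w (M.J BY X Z N n w)‖ₑ ^ 2 ∂P ≤ K := by
  obtain ⟨KX, hKX, hXle⟩ := hX.exists_lintegral_le hB
  obtain ⟨K, hK, hbound⟩ := hM.exists_bound ht
  -- `80 K⁸ = 5 (4 K⁴)²`, the `5` coming from Cauchy–Schwarz for a sum of five terms.
  refine ⟨ENNReal.ofReal (80 * K ^ 8) * (KX + KX + ENNReal.ofReal (‖M.level‖ ^ 2)
    + ENNReal.ofReal K + ENNReal.ofReal K), ?_, fun N n hN h1 h2 u hu => ?_⟩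
  · exact ENNReal.mul_ne_top ENNReal.ofReal_ne_top (by simp [hKX])
  obtain ⟨hK1, hK2, hK3, hK4⟩ := hbound u hu
  have hPd := hM.condPrec_posDef ht hu
  have hF := (hM.F_posDef h1 h2).posSemidef
  have hQ := (hPd.add_posSemidef hF).inv.posSemidef
  -- Here the dependence on `N` and `n` disappears: `tr(Q F Q) ≤ tr Σ(1-u)`.
  have hcov := (hPd.trace_conj_inv_add_le hF).trans_eq (by rw [hM.condPrec_inv ht hu])
  have hY := (hM.lintegral_sum_Y_le hBY h2 hQ).trans
    (ENNReal.ofReal_le_ofReal (hcov.trans hK4))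
  have hZ' := (hM.lintegral_sum_Z_le hBZ h2 (z := Z N)
    (fun m hm => hZ N m hN (Finset.mem_Icc.1 hm).1 ((Finset.mem_Icc.1 hm).2.trans h2)) hQ).trans
    (ENNReal.ofReal_le_ofReal (hcov.trans hK4))
  have hpath := hM.norm_driftAt_J_le (BY := BY) (X := X) (Z := Z) ht hu hK hK1 hK2 hK3 hK4 h1 h2
  set Q := (M.condPrec (1 - u) + M.F N n)⁻¹
  set SY : Ω → Vec d := fun w => act Q (∑ m ∈ Finset.Icc 1 n, act (M.E N m) (M.Y BY N m w))
  set SZ : Ω → Vec d := fun w => act Q (∑ m ∈ Finset.Icc 1 n, act (M.E N m)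
    ((1 / M.alpha N m) • act (M.C N m)⁻¹ (Z N m w)))
  have hSY : Measurable SY := (Matrix.toEuclideanCLM (𝕜 := ℝ) Q).measurable.comp
    (Finset.measurable_fun_sum _ fun m _ =>
      (Matrix.toEuclideanCLM (𝕜 := ℝ) (M.E N m)).measurable.comp (measurable_Y hBY.measurable N m))
  have hm : ∀ {V : Ω → Vec d}, Measurable V → Measurable fun w => ‖V w‖ₑ ^ 2 :=
    fun hV => hV.enorm.pow_const 2
  have hX1 := hm (hX.measurable 1)
  have hXu := hm (hX.measurable u)
  calc ∫⁻ w, ‖M.driftAt X N n u w (M.J BY X Z N n w)‖ₑ ^ 2 ∂P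
      ≤ ∫⁻ w, ENNReal.ofReal (80 * K ^ 8) * (‖X 1 w‖ₑ ^ 2 + ‖X u w‖ₑ ^ 2
          + ENNReal.ofReal (‖M.level‖ ^ 2) + ‖SY w‖ₑ ^ 2 + ‖SZ w‖ₑ ^ 2) ∂P := by
        refine lintegral_mono fun w => ?_
        simp only [enorm_sq_eq_ofReal]
        rw [← ENNReal.ofReal_add (by positivity) (by positivity),
          ← ENNReal.ofReal_add (by positivity) (by positivity),
          ← ENNReal.ofReal_add (by positivity) (by positivity),
          ← ENNReal.ofReal_add (by positivity) (by positivity),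
          ← ENNReal.ofReal_mul (by positivity)]
        refine ENNReal.ofReal_le_ofReal ?_
        refine (pow_le_pow_left₀ (norm_nonneg _) (hpath w) 2).trans ?_
        have key : ∀ a b c e f : ℝ, (a + b + c + e + f) ^ 2
            ≤ 5 * (a ^ 2 + b ^ 2 + c ^ 2 + e ^ 2 + f ^ 2) := fun a b c e f => by
          nlinarith [sq_nonneg (a - b), sq_nonneg (a - c), sq_nonneg (a - e), sq_nonneg (a - f),
            sq_nonneg (b - c), sq_nonneg (b - e), sq_nonneg (b - f), sq_nonneg (c - e),
            sq_nonneg (c - f), sq_nonneg (e - f)]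
        rw [mul_pow]
        refine (mul_le_mul_of_nonneg_left (key _ _ _ _ _) (by positivity)).trans_eq ?_
        ring
    _ ≤ _ := by
        -- `SZ` stands last because `Z` is determined only up to null sets, and splitting the
        -- integral needs measurability of the left summand only.
        rw [lintegral_const_mul' _ _ ENNReal.ofReal_ne_top,
          lintegral_add_left (by exact ((hX1.add hXu).add measurable_const).add (hm hSY)),
          lintegral_add_left (by exact (hX1.add hXu).add measurable_const),
          lintegral_add_left (by exact hX1.add hXu), lintegral_add_left hX1, lintegral_const,
          measure_univ, mul_one]
        gcongr
        · exact hXle 1 (by simp)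
        · exact hXle u ⟨hu.1, hu.2.trans ht.le⟩

end Drift

end MarketData

/-! ### Disjoint activity intervals and joint measurability of the drift -/

namespace MarketData

variable {d : ℕ} {M : MarketData d} {Ω : Type*} {BY : ℝ≥0 → Ω → Vec d} {X : ℝ → Ω → Vec d}
  {Z : ℕ → ℕ → Ω → Vec d}

lemma _root_.aestronglyMeasurable_act {α : Type*} [MeasurableSpace α] {μ : Measure α}
    {A : α → Mat d} {V : α → Vec d}
    (hA : AEStronglyMeasurable (fun q => Matrix.toEuclideanCLM (𝕜 := ℝ) (A q)) μ)
    (hV : AEStronglyMeasurable V μ) : AEStronglyMeasurable (fun q => act (A q) (V q)) μ :=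
  isBoundedBilinearMap_apply.continuous.comp_aestronglyMeasurable (hA.prodMk hV)

/-- Outside time `0` the information drift is a sum over disjoint time intervals. -/
lemma infoDrift_eq_sum_indicator {N : ℕ} {u : ℝ} (hu : u ≠ 0) (w : Ω) :
    M.infoDrift BY X Z N u w = ∑ n ∈ Finset.Icc 1 (2 ^ N),
      (Set.Ioc (M.time N n) (M.time N (n + 1))).indicator
        (fun s => M.driftAt X N n s w (M.J BY X Z N n w)) u := by
  rw [infoDrift, if_neg hu]
  refine Finset.sum_congr rfl fun n _ => ?_
  simp only [Set.indicator_apply, Set.mem_Ioc]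

/-- At each time the information drift is zero or the drift of a single insider. -/
lemma Admissible.infoDrift_eq_zero_or (hM : M.Admissible) (N : ℕ) {u : ℝ} (hu : u ≠ 0) :
    (∀ w, M.infoDrift BY X Z N u w = 0) ∨ ∃ n, 1 ≤ n ∧ n ≤ 2 ^ N ∧
      ∀ w, M.infoDrift BY X Z N u w = M.driftAt X N n u w (M.J BY X Z N n w) := by
  simp_rw [infoDrift_eq_sum_indicator hu]
  by_cases h : ∃ n ∈ Finset.Icc 1 (2 ^ N), u ∈ Set.Ioc (M.time N n) (M.time N (n + 1))
  · obtain ⟨n, hn, hun⟩ := h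
    have hn' := Finset.mem_Icc.1 hn
    refine Or.inr ⟨n, hn'.1, hn'.2, fun w => ?_⟩
    rw [Finset.sum_eq_single_of_mem n hn, Set.indicator_of_mem hun]
    intro m hm hmn
    have hm' := Finset.mem_Icc.1 hm
    refine Set.indicator_of_notMem (fun hum => ?_) _
    rcases Nat.lt_or_gt_of_ne hmn with hlt | hlt
    · exact absurd (hum.2.trans (hM.time_le_time (by lia) hlt hn'.2)) (not_le.2 hun.1)
    · exact absurd (hun.2.trans (hM.time_le_time (by lia) hlt hm'.2)) (not_le.2 hum.1)
  · push Not at h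
    exact Or.inl fun w => Finset.sum_eq_zero fun n hn => Set.indicator_of_notMem (h n hn) _

variable [MeasurableSpace Ω] {P : Measure Ω} {B BZ : ℝ≥0 → Ω → Vec d}

lemma IsNoiseDemand.aestronglyMeasurable {N n : ℕ} {z : Ω → Vec d}
    (h : M.IsNoiseDemand P BZ N n z) : AEStronglyMeasurable z P := by
  obtain ⟨I, hI, hz⟩ := h
  exact (aestronglyMeasurable_act aestronglyMeasurable_const hI.2.1.1).congr hz.symm

lemma aestronglyMeasurable_J (hBY : IsBrownianVec BY P) (hX : M.IsOU P B X)
    (hZ : ∀ N n : ℕ, 1 ≤ N → 1 ≤ n → n ≤ 2 ^ N → M.IsNoiseDemand P BZ N n (Z N n))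
    {N n : ℕ} (hN : 1 ≤ N) (h2 : n ≤ 2 ^ N) : AEStronglyMeasurable (M.J BY X Z N n) P := by
  refine aestronglyMeasurable_act aestronglyMeasurable_const
    (Finset.aestronglyMeasurable_fun_sum _ fun m hm =>
      aestronglyMeasurable_act aestronglyMeasurable_const ?_)
  have hm' := Finset.mem_Icc.1 hm
  refine (((hX.measurable 1).add (measurable_Y hBY.measurable N m)).aestronglyMeasurable).add ?_
  exact (aestronglyMeasurable_act aestronglyMeasurable_const
    (hZ N m hN hm'.1 (hm'.2.trans h2)).aestronglyMeasurable).const_smul (1 / M.alpha N m)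

/-- Joint measurability of a time dependent matrix acting on a random vector. -/
lemma _root_.ContinuousOn.aestronglyMeasurable_act_prod [SFinite P] {A : ℝ → Mat d}
    {t : ℝ} (hA : ContinuousOn A (Set.Icc 0 t)) {V : Ω × ℝ → Vec d}
    (hV : AEStronglyMeasurable V (P.prod (volume.restrict (Set.Icc 0 t)))) :
    AEStronglyMeasurable (fun q : Ω × ℝ => act (A q.2) (V q))
      (P.prod (volume.restrict (Set.Icc 0 t))) := by
  have h1 : ContinuousOn (fun u => Matrix.toEuclideanCLM (𝕜 := ℝ) (A u)) (Set.Icc 0 t) :=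
    continuous_toEuclideanCLM.comp_continuousOn hA
  have h2 := (h1.aestronglyMeasurable (μ := volume) measurableSet_Icc).comp_snd (μ := P)
  exact aestronglyMeasurable_act (A := fun q : Ω × ℝ => A q.2) h2 hV

lemma IsOU.aestronglyMeasurable_condMean [SFinite P] (hX : M.IsOU P B X) {t : ℝ} (ht : t < 1) :
    AEStronglyMeasurable (fun q : Ω × ℝ => M.condMean (X q.2 q.1) (1 - q.2))
      (P.prod (volume.restrict (Set.Icc 0 t))) := by
  have hXj : AEStronglyMeasurable (fun q : Ω × ℝ => X q.2 q.1)
      (P.prod (volume.restrict (Set.Icc 0 t))) :=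
    (aestronglyMeasurable_of_ae_continuousOn hX.measurable hX.cont).mono_measure
      (Measure.prod_mono le_rfl (Measure.restrict_mono (Set.Icc_subset_Icc_right ht.le) le_rfl))
  have hexp : ContinuousOn (fun u : ℝ => NormedSpace.exp (-((1 - u) • M.kappa))) (Set.Icc 0 t) :=
    ((continuous_exp_neg_smul M.kappa).comp
      (continuous_const.sub continuous_id : Continuous fun u : ℝ => 1 - u)).continuousOn
  have h := hexp.aestronglyMeasurable_act_prod
    (hXj.sub (aestronglyMeasurable_const (b := M.level)))
  exact aestronglyMeasurable_const.add h

lemma Admissible.continuousOn_inv_add (hM : M.Admissible) {t : ℝ} (ht : t < 1) {F : Mat d}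
    (hF : F.PosSemidef) :
    ContinuousOn (fun u => (M.condPrec (1 - u) + F)⁻¹) (Set.Icc 0 t) := by
  have hPF : ContinuousOn (fun u => M.condPrec (1 - u) + F) (Set.Icc 0 t) :=
    (hM.continuousOn_condPrec ht).add continuousOn_const
  have hdet : ContinuousOn (fun u => (M.condPrec (1 - u) + F).det) (Set.Icc 0 t) :=
    continuous_id.matrix_det.comp_continuousOn hPF
  have hadj : ContinuousOn (fun u => (M.condPrec (1 - u) + F).adjugate) (Set.Icc 0 t) :=
    continuous_id.matrix_adjugate.comp_continuousOn hPF
  simp only [Matrix.inv_def, Ring.inverse_eq_inv']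
  exact (hdet.inv₀ fun u hu => ((hM.condPrec_posDef ht hu).add_posSemidef hF).det_pos.ne').smul hadj

/-- Joint measurability of the drift of a single insider. -/
lemma Admissible.aestronglyMeasurable_driftAt [IsProbabilityMeasure P] (hM : M.Admissible)
    (hBY : IsBrownianVec BY P) (hX : M.IsOU P B X)
    (hZ : ∀ N n : ℕ, 1 ≤ N → 1 ≤ n → n ≤ 2 ^ N → M.IsNoiseDemand P BZ N n (Z N n))
    {t : ℝ} (ht : t < 1) {N n : ℕ} (hN : 1 ≤ N) (h1 : 1 ≤ n) (h2 : n ≤ 2 ^ N) :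
    AEStronglyMeasurable (fun q : Ω × ℝ => M.driftAt X N n q.2 q.1 (M.J BY X Z N n q.1))
      (P.prod (volume.restrict (Set.Icc 0 t))) := by
  have hA : ContinuousOn (fun u => M.driftGain u * (M.condPrec (1 - u) + M.F N n)⁻¹ * M.F N n)
      (Set.Icc 0 t) :=
    ((hM.continuousOn_driftGain ht).mul
      (hM.continuousOn_inv_add ht (hM.F_posDef h1 h2).posSemidef)).mul continuousOn_const
  have hJ : AEStronglyMeasurable (fun q : Ω × ℝ => M.J BY X Z N n q.1)
      (P.prod (volume.restrict (Set.Icc 0 t))) :=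
    (aestronglyMeasurable_J hBY hX hZ hN h2).comp_fst
  exact hA.aestronglyMeasurable_act_prod (hJ.sub (hX.aestronglyMeasurable_condMean ht))

lemma Admissible.aestronglyMeasurable_infoDrift [IsProbabilityMeasure P] (hM : M.Admissible) (hBY : IsBrownianVec BY P)
    (hX : M.IsOU P B X)
    (hZ : ∀ N n : ℕ, 1 ≤ N → 1 ≤ n → n ≤ 2 ^ N → M.IsNoiseDemand P BZ N n (Z N n))
    {t : ℝ} (ht : t < 1) {N : ℕ} (hN : 1 ≤ N) :
    AEStronglyMeasurable (fun q : Ω × ℝ => M.infoDrift BY X Z N q.2 q.1)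
      (P.prod (volume.restrict (Set.Icc 0 t))) := by
  have hsum : AEStronglyMeasurable (fun q : Ω × ℝ => ∑ n ∈ Finset.Icc 1 (2 ^ N),
      (Prod.snd ⁻¹' Set.Ioc (M.time N n) (M.time N (n + 1))).indicator
        (fun q : Ω × ℝ => M.driftAt X N n q.2 q.1 (M.J BY X Z N n q.1)) q)
      (P.prod (volume.restrict (Set.Icc 0 t))) :=
    Finset.aestronglyMeasurable_fun_sum _ fun n hn =>
      (hM.aestronglyMeasurable_driftAt hBY hX hZ ht hN (Finset.mem_Icc.1 hn).1
        (Finset.mem_Icc.1 hn).2).indicator (measurable_snd measurableSet_Ioc)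
  refine hsum.congr ?_
  -- The separate definition at time `0` concerns a Lebesgue null set.
  have h0 : ∀ᵐ u ∂(volume.restrict (Set.Icc 0 t)), u ≠ (0 : ℝ) :=
    ae_restrict_of_ae (Measure.ae_ne volume 0)
  have h0' : ∀ᵐ q ∂(P.prod (volume.restrict (Set.Icc 0 t))), q.2 ≠ (0 : ℝ) :=
    Measure.quasiMeasurePreserving_snd.ae h0
  filter_upwards [h0'] with q hq
  rw [infoDrift_eq_sum_indicator hq]
  rfl

end MarketData

/-! ### The uniform `L²` bound -/

theorem propositionP {Ω : Type*} [MeasurableSpace Ω] (P : Measure Ω) [IsProbabilityMeasure P]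
    (d : ℕ) (M : MarketData d) (hM : M.Admissible)
    (B BY BZ : ℝ≥0 → Ω → Vec d)
    (hB : IsBrownianVec B P) (hBY : IsBrownianVec BY P) (hBZ : IsBrownianVec BZ P)
    (hindep : iIndepFun (fun (k : Fin 3) (w : Ω) (t : ℝ≥0) => (![B, BY, BZ] k) t w) P)
    (X : ℝ → Ω → Vec d) (hX : M.IsOU P B X)
    (Z : ℕ → ℕ → Ω → Vec d)
    (hZ : ∀ N n : ℕ, 1 ≤ N → 1 ≤ n → n ≤ 2 ^ N → M.IsNoiseDemand P BZ N n (Z N n))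
    (t : ℝ) (ht : t ∈ Set.Ico (0 : ℝ) 1) :
    (∀ N : ℕ, 1 ≤ N → M.weight N 1 ≠ 0 →
      AEStronglyMeasurable (fun q : Ω × ℝ => M.infoDrift BY X Z N q.2 q.1)
        (P.prod (volume.restrict (Set.Icc 0 t)))) ∧
    (⨆ (N : ℕ) (_ : 1 ≤ N ∧ M.weight N 1 ≠ 0),
      ∫⁻ w, (∫⁻ u in Set.Icc 0 t, ‖M.infoDrift BY X Z N u w‖ₑ ^ 2) ∂P) < ∞ := by
  have hmeas : ∀ N : ℕ, 1 ≤ N → AEStronglyMeasurable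
      (fun q : Ω × ℝ => M.infoDrift BY X Z N q.2 q.1)
      (P.prod (volume.restrict (Set.Icc 0 t))) := fun N hN =>
    hM.aestronglyMeasurable_infoDrift hBY hX hZ ht.2 hN
  refine ⟨fun N hN _ => hmeas N hN, ?_⟩
  obtain ⟨K, hK, hle⟩ := hM.exists_lintegral_driftAt_le hB hBY hBZ hX hZ ht.2
  refine lt_of_le_of_lt (iSup₂_le fun N hN => ?_)
    (ENNReal.mul_lt_top hK.lt_top (measure_Icc_lt_top (a := (0 : ℝ)) (b := t) (μ := volume)))
  -- After Tonelli the expectation at each fixed `u` is at most `K`, and `[0,t]` has finite length.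
  rw [lintegral_lintegral_swap (f := fun w u => ‖M.infoDrift BY X Z N u w‖ₑ ^ 2)
    ((hmeas N hN.1).enorm.pow_const 2), ← setLIntegral_const]
  refine lintegral_mono_ae ?_
  have h0 : ∀ᵐ u ∂(volume.restrict (Set.Icc 0 t)), u ≠ (0 : ℝ) :=
    ae_restrict_of_ae (Measure.ae_ne volume 0)
  filter_upwards [h0, ae_restrict_mem measurableSet_Icc] with u hu hut
  rcases hM.infoDrift_eq_zero_or (BY := BY) (X := X) (Z := Z) N hu with h | ⟨n, h1, h2, h⟩
  · simp [h]
  · simp_rw [h]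
    exact hle N n hN.1 h1 h2 u hut
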